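/- **Setting.** Let $\Bbbk$ be a field and let $Q\subseteq\mathbb Z^d$ be a normal affine semigroup: a finitely generated submonoid that has no nontrivial units, generates $\mathbb Z^d$ as a group, and is saturated (if $n\ge1$, $a\in\mathbb Z^d$ and $na\in Q$, then $a\in Q$). Modules are $\mathbb Z^d$-graded $\Bbbk[Q]$-modules and homomorphisms have degree $0$. A *face* $F$ of $Q$ is a nonempty subset of $Q$ on which some linear functional attains its minimum over $Q$; a *facet* is a face of codimension $1$. For $T\subseteq\mathbb Z^d$ of the form $\alpha+F-Q$ or $\alpha-F+Q$, with $\alpha\in\mathbb Z^d$ and $F$ a face, $\Bbbk\{T\}$ is the module with $\Bbbk$-basis $\{\mathbf x^\beta\mid\beta\in T\}$, where $\mathbf x^a\mathbf x^\beta=\mathbf x^{a+\beta}$ if $a+\beta\in T$ and $\mathbf x^a\mathbf x^\beta=0$ otherwise. As usual in this context, an *injective* module means one isomorphic to a finite direct sum of modules $\Bbbk\{\alpha+F-Q\}$, and a *flat* module means one isomorphic to a finite direct sum of their Matlis duals $\Bbbk\{\alpha-F+Q\}$. A *sector partition* of a module $H$ consists of (1) a finite partition of $\mathbb Z^d$ into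 sectors $S\in\mathcal S$, each consisting of the lattice points in a finite disjoint union of rational polyhedra that are intersections of half-spaces for hyperplanes parallel to facets of $Q$; (2) a finite-dimensional vector space $H_S$ for each $S\in\mathcal S$, with isomorphisms $H_\alpha\to H_S$ for all $\alpha\in S$; (3) linear maps $\mathbf x^{T-S}:H_S\to H_T$ whenever there are $\alpha\in S$, $\beta\in T$ with $\beta-\alpha\in Q$, such that for all such $\alpha,\beta$ the maps $\mathbf x^{\beta-\alpha}:H_\alpha\to H_\beta$ and $\mathbf x^{T-S}:H_S\to H_T$ commute with the isomorphisms in (2). **Theorem.** Let $J'\xrightarrow{\varphi}J\xrightarrow{\psi}J''$ be a complex in which all three modules are injective, or all three are flat, and let $H\cong\ker\psi/\operatorname{im}\varphi$ be its middle homology. Then $H$ has a sector partition that is determined by the complex, in the following sense. There is a single sector partition of $H$ such that, for every choice of decompositions $J'=\bigoplus_{i=1}^{r'}J'_i$, $J=\bigoplus_{i=1}^{r}J_i$, $J''=\bigoplus_{i=1}^{r''}J''_i$ into summands $\Bbbk\{\alpha_i+F_i-Q\}$ (respectively $\Bbbk\{\alpha_i-F_i+Q\}$), the following hold. * The maps $\varphi,\psi$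 are given by monomial matrices $\Phi,\Psi$. That is, the component from the $q$-th to the $p$-th summand sends $\mathbf x^\beta$ to $\lambda_{qp}\mathbf x^\beta$ if $\beta$ is a degree of the $p$-th summand, and to $0$ otherwise; here the scalars satisfy $\lambda_{qp}=0$ unless $F_p\subseteq F_q$ and $\alpha_p\in\alpha_q+F_q-Q$ (respectively, unless $F_q\subseteq F_p$ and $\alpha_q\in\alpha_p-F_p+Q$). * The sectors are the nonempty sets among the $S_{A',A,A''}$, for $A'\subseteq\{1,\dots,r'\}$, $A\subseteq\{1,\dots,r\}$, $A''\subseteq\{1,\dots,r''\}$, where $S_{A',A,A''}$ is the set of degrees in which the nonzero summands of $J'$, $J$, $J''$ are precisely those indexed by $A'$, $A$, $A''$. * The vector space for the sector $S_{A',A,A''}$ is identified with $\ker(\Psi_A^{A''})/\operatorname{im}(\Phi_{A'}^{A})$, where $\Phi_{A'}^{A}:\Bbbk^{A'}\to\Bbbk^{A}$ and $\Psi_A^{A''}:\Bbbk^{A}\to\Bbbk^{A''}$ are the submatrices of $\Phi$ and $\Psi$ with rows and columns in the indicated sets. The isomorphism from $H_\alpha$, for $\alpha\in S_{A',A,A''}$,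 is induced by the map $J_\alpha\to\Bbbk^A$ sending the element $\mathbf x^\alpha$ of $J_i$ to $e_i$. * The map $\mathbf x^{T-S}$ from $S=S_{A',A,A''}$ to $T=S_{B',B,B''}$ is induced by the map $\Bbbk^A\to\Bbbk^B$ with $e_i\mapsto e_i$ if $i\in B$ and $e_i\mapsto0$ otherwise. -/

import Mathlib

universe u v v' v'' w

/-! ## Affine semigroups, faces, facets, polyhedra -/

/-- `Q ⊆ ℤ^d` is a saturated (normal) affine semigroup: a finitely generated submonoid of `ℤ^d`
without nontrivial units, generating `ℤ^d` as a group, and saturated in `ℤ^d`. -/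
structure IsNormalAffineSemigroup {d : ℕ} (Q : AddSubmonoid (Fin d → ℤ)) : Prop where
  fg : Q.FG
  sharp : ∀ a, a ∈ Q → -a ∈ Q → a = 0
  generates : AddSubgroup.closure (Q : Set (Fin d → ℤ)) = ⊤
  saturated : ∀ (n : ℕ) (a : Fin d → ℤ), n ≠ 0 → n • a ∈ Q → a ∈ Q

/-- A face of `Q` is the (nonempty) set of points of `Q` at which some real linear functional
attains its minimum over `Q`. -/
def IsFace {d : ℕ} (Q : AddSubmonoid (Fin d → ℤ)) (F : Set (Fin d → ℤ)) : Prop :=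
  F.Nonempty ∧ ∃ l : (Fin d → ℤ) →+ ℝ, F = {a | a ∈ Q ∧ ∀ b ∈ Q, l a ≤ l b}

/-- A facet is a face of codimension one. -/
def IsFacet {d : ℕ} (Q : AddSubmonoid (Fin d → ℤ)) (F : Set (Fin d → ℤ)) : Prop :=
  IsFace Q F ∧ Module.finrank ℤ (Submodule.span ℤ F) + 1 = d

/-- A closed rational half-space of `ℝ^d` whose bounding hyperplane is parallel to a facet
of `Q`. (Both sides of the hyperplane are covered, since `t` may be replaced by `-t`.) -/
def IsFacetHalfSpace {d : ℕ} (Q : AddSubmonoid (Fin d → ℤ)) (X : Set (Fin d → ℝ)) : Prop :=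
  ∃ (F : Set (Fin d → ℤ)) (t : Fin d → ℤ) (c : ℚ), IsFacet Q F ∧ t ≠ 0 ∧
    (∀ a ∈ F, ∑ j, t j * a j = 0) ∧ X = {x | ∑ j, (t j : ℝ) * x j ≤ (c : ℝ)}

/-- A rational polyhedron: a finite intersection of half-spaces as above. -/
def IsFacetPolyhedron {d : ℕ} (Q : AddSubmonoid (Fin d → ℤ)) (X : Set (Fin d → ℝ)) : Prop :=
  ∃ C : Set (Set (Fin d → ℝ)), C.Finite ∧ (∀ Y ∈ C, IsFacetHalfSpace Q Y) ∧ X = ⋂₀ C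

/-- `S ⊆ ℤ^d` consists of the lattice points in a finite disjoint union of such polyhedra. -/
def IsPolyhedralRegion {d : ℕ} (Q : AddSubmonoid (Fin d → ℤ)) (S : Set (Fin d → ℤ)) : Prop :=
  ∃ C : Set (Set (Fin d → ℝ)), C.Finite ∧ (∀ X ∈ C, IsFacetPolyhedron Q X) ∧
    C.PairwiseDisjoint id ∧ S = {a | (fun j => (a j : ℝ)) ∈ ⋃₀ C}

/-! ## `ℤ^d`-graded modules over the semigroup ring `k[Q]` -/

/-- A `ℤ^d`-graded module over the semigroup ring `k[Q]`. -/
structure ZGradedModule (k : Type u) [Field k] {d : ℕ} (Q : AddSubmonoid (Fin d → ℤ)) where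
  carrier : Type v
  [addCommGroup : AddCommGroup carrier]
  [moduleBase : Module k carrier]
  [module : Module (AddMonoidAlgebra k Q) carrier]
  [isScalarTower : IsScalarTower k (AddMonoidAlgebra k Q) carrier]
  /-- the graded pieces -/
  deg : (Fin d → ℤ) → Submodule k carrier
  isInternal : DirectSum.IsInternal deg
  monomial_smul_mem : ∀ (a : Q) (α : Fin d → ℤ), ∀ m ∈ deg α,
    (AddMonoidAlgebra.single a (1 : k)) • m ∈ deg (α + a)

namespace ZGradedModule

attribute [instance] addCommGroup moduleBase module isScalarTower

variable {k : Type u} [Field k] {d : ℕ} {Q : AddSubmonoid (Fin d → ℤ)}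

/-- Multiplication by the monomial `x^(β - α)`, as a map `M_α → M_β`. -/
noncomputable def mulMonomial (M : ZGradedModule.{u, v} k Q) {α β : Fin d → ℤ} (h : β - α ∈ Q) :
    M.deg α →ₗ[k] M.deg β where
  toFun m := ⟨AddMonoidAlgebra.single (⟨β - α, h⟩ : Q) (1 : k) • (m : M.carrier), by
    have := M.monomial_smul_mem ⟨β - α, h⟩ α m m.2
    simpa using this⟩
  map_add' x y := by ext; simp
  map_smul' c x := by
    ext
    simp only [Submodule.coe_smul, RingHom.id_apply]
    rw [smul_algebra_smul_comm]

/-- A module homomorphism of degree `0`. -/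
def IsGradedHom (M : ZGradedModule.{u, v} k Q) (N : ZGradedModule.{u, w} k Q)
    (f : M.carrier →ₗ[AddMonoidAlgebra k Q] N.carrier) : Prop :=
  ∀ α, ∀ m ∈ M.deg α, f m ∈ N.deg α

/-- The direct sum of finitely many graded modules. -/
noncomputable def directSum {r : ℕ} (M : Fin r → ZGradedModule.{u, v} k Q) : ZGradedModule.{u, v} k Q where
  carrier := ∀ i, (M i).carrier
  deg α := Submodule.pi Set.univ fun i => (M i).deg α
  isInternal := by
    apply DirectSum.isInternal_submodule_of_iSupIndep_of_iSup_eq_top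
    · intro α
      rw [Submodule.disjoint_def]
      intro x hx hx'
      funext i
      have h1 : x i ∈ (M i).deg α := hx i trivial
      have h2 : x i ∈ ⨆ (β) (_ : β ≠ α), (M i).deg β := by
        have h3 : (⨆ (β) (_ : β ≠ α), Submodule.pi Set.univ fun i => (M i).deg β) ≤
            (⨆ (β) (_ : β ≠ α), (M i).deg β).comap (LinearMap.proj (R := k) i) := by
          refine iSup₂_le fun β hβ y hy => ?_
          exact (le_iSup₂ (f := fun β (_ : β ≠ α) => (M i).deg β) β hβ) (hy i trivial)
        exact h3 hx'
      exact (Submodule.disjoint_def.1 ((M i).isInternal.submodule_iSupIndep α)) _ h1 h2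
    · rw [eq_top_iff]
      intro x _
      have hx : x = ∑ i, Pi.single i (x i) := (Finset.univ_sum_single x).symm
      rw [hx]
      refine Submodule.sum_mem _ fun i _ => ?_
      have h1 : x i ∈ ⨆ β, (M i).deg β := by
        rw [(M i).isInternal.submodule_iSup_eq_top]; trivial
      have h3 : (⨆ β, (M i).deg β) ≤ (⨆ β, Submodule.pi Set.univ fun i => (M i).deg β).comap
          (LinearMap.single k (fun i => (M i).carrier) i) := by
        refine iSup_le fun β y hy => ?_
        refine (le_iSup (fun β => Submodule.pi Set.univ fun i => (M i).deg β) β) ?_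
        intro j _
        by_cases hj : j = i
        · subst hj; simpa using hy
        · simp [Pi.single_eq_of_ne hj]
      exact h3 h1
  monomial_smul_mem a α m hm i _ := (M i).monomial_smul_mem a α _ (hm i trivial)

end ZGradedModule

/-! ## The modules `k{T}` -/

section MonomialModule

variable (k : Type u) [Field k] {d : ℕ} (Q : AddSubmonoid (Fin d → ℤ)) (T : Set (Fin d → ℤ))

open Classical in
/-- On the vector space `k{T}` with basis `x^β`, `β ∈ T`: the operator `x^a`, sending `x^β` to
`x^(β + a)` if `β + a ∈ T` and to `0` otherwise. -/
noncomputable def monomialAction (a : Fin d → ℤ) : (T →₀ k) →ₗ[k] (T →₀ k) :=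
  Finsupp.linearCombination k fun β : T =>
    if h : (β : Fin d → ℤ) + a ∈ T then Finsupp.single (⟨β + a, h⟩ : T) (1 : k) else 0

/-- The condition on `T` under which these operators turn `k{T}` into a `k[Q]`-module. It holds
when `T` is closed under addition of elements of `-Q`, and when `T` is closed under addition of
elements of `Q`. -/
def IsSemigroupConvex : Prop :=
  ∀ β ∈ T, ∀ a ∈ Q, ∀ b ∈ Q, β + a + b ∈ T → β + a ∈ T

variable {Q T}

/-- The action of the semigroup `Q` on `k{T}`. -/
noncomputable def monomialActionHom (hT : IsSemigroupConvex Q T) :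
    Multiplicative Q →* Module.End k (T →₀ k) where
  toFun a := monomialAction k T (a.toAdd : Q)
  map_one' := by
    ext β : 2
    simp [monomialAction]
  map_mul' a b := by
    have key : ∀ a' b' : Q, monomialAction k T ((a' + b' : Q) : Fin d → ℤ) =
        monomialAction k T (a' : Fin d → ℤ) * monomialAction k T (b' : Fin d → ℤ) := by
      rintro ⟨a, ha⟩ ⟨b, hb⟩
      refine Finsupp.lhom_ext' fun β => LinearMap.ext_ring ?_
      obtain ⟨β, hβ⟩ := β
      have e : β + (a + b) = β + b + a := by abel
      by_cases h1 : β + b ∈ T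
      · by_cases h2 : β + b + a ∈ T
        · simp [monomialAction, h1, h2, e]
        · simp [monomialAction, h1, h2, e]
      · have h2 : β + b + a ∉ T := fun h => h1 (hT β hβ b hb a ha h)
        simp [monomialAction, h1, h2, e]
    exact key a.toAdd b.toAdd

variable (T) in
/-- The graded pieces of `k{T}`: in degree `α`, the span of `x^α` if `α ∈ T`, and `0` otherwise. -/
noncomputable def monomialDeg (α : Fin d → ℤ) : Submodule k (T →₀ k) :=
  Finsupp.supported k k {β : T | (β : Fin d → ℤ) = α}

theorem monomialDeg_isInternal : DirectSum.IsInternal (monomialDeg k T) := by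
  apply DirectSum.isInternal_submodule_of_iSupIndep_of_iSup_eq_top
  · intro α
    have e : (⨆ (β) (_ : β ≠ α), monomialDeg k T β) ≤
        Finsupp.supported k k {γ : T | (γ : Fin d → ℤ) ≠ α} := by
      refine iSup₂_le fun β hβ => Finsupp.supported_mono fun γ hγ h => hβ ?_
      exact hγ.symm.trans h
    refine Disjoint.mono_right e (Finsupp.disjoint_supported_supported ?_)
    rw [Set.disjoint_left]
    exact fun β hβ hβ' => hβ' hβ
  · rw [eq_top_iff, ← Finsupp.supported_univ]
    refine le_trans (Finsupp.supported_mono (t := ⋃ α, {β : T | (β : Fin d → ℤ) = α})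
      fun β _ => Set.mem_iUnion.2 ⟨β, rfl⟩) ?_
    rw [Finsupp.supported_iUnion]
    exact le_rfl

theorem monomialAction_mem (a α : Fin d → ℤ) (m : T →₀ k) (hm : m ∈ monomialDeg k T α) :
    monomialAction k T a m ∈ monomialDeg k T (α + a) := by
  rw [monomialAction, Finsupp.linearCombination_apply]
  refine Submodule.sum_mem _ fun β hβ => Submodule.smul_mem _ _ ?_
  have hβα : (β : Fin d → ℤ) = α := hm hβ
  split_ifs with h
  · refine Finsupp.single_mem_supported k (1 : k) ?_
    change (β : Fin d → ℤ) + a = α + a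
    rw [hβα]
  · exact Submodule.zero_mem _

/-- The action of the semigroup ring `k[Q]` on `k{T}`. -/
noncomputable def monomialAlgHom (hT : IsSemigroupConvex Q T) :
    AddMonoidAlgebra k Q →ₐ[k] Module.End k (T →₀ k) :=
  AddMonoidAlgebra.lift k (Module.End k (T →₀ k)) Q (monomialActionHom k hT)

theorem monomialAlgHom_single (hT : IsSemigroupConvex Q T) (a : Q) :
    monomialAlgHom k hT (AddMonoidAlgebra.single a 1) = monomialAction k T a := by
  rw [monomialAlgHom, AddMonoidAlgebra.lift_single, one_smul]
  rfl

/-- The `ℤ^d`-graded `k[Q]`-module `k{T}`. -/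
noncomputable def monomialModule (hT : IsSemigroupConvex Q T) : ZGradedModule.{u, u} k Q :=
  letI : Module (AddMonoidAlgebra k Q) (T →₀ k) :=
    Module.compHom _ (monomialAlgHom k hT).toRingHom
  haveI : IsScalarTower k (AddMonoidAlgebra k Q) (T →₀ k) :=
    ⟨fun c f m => by
      change monomialAlgHom k hT (c • f) m = c • monomialAlgHom k hT f m
      rw [map_smul]; rfl⟩
  { carrier := T →₀ k
    deg := monomialDeg k T
    isInternal := monomialDeg_isInternal k
    monomial_smul_mem := by
      intro a α m hm
      change monomialAlgHom k hT (AddMonoidAlgebra.single a 1) m ∈ _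
      rw [monomialAlgHom_single]
      exact monomialAction_mem k _ _ _ hm }

end MonomialModule

/-! ## Injective and flat modules -/

/-- The two types of modules under consideration. -/
inductive SummandType
  | injective
  | flat

/-- The set of degrees of an indecomposable injective or flat module: `α + F - Q` in the
injective case, and `α - F + Q` in the flat case. -/
def summandSupport {d : ℕ} (Q : AddSubmonoid (Fin d → ℤ)) :
    SummandType → (Fin d → ℤ) → Set (Fin d → ℤ) → Set (Fin d → ℤ)
  | .injective, α, F => {β | ∃ f ∈ F, ∃ q ∈ Q, β = α + f - q}
  | .flat, α, F => {β | ∃ f ∈ F, ∃ q ∈ Q, β = α - f + q}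

theorem summandSupport_convex {d : ℕ} (Q : AddSubmonoid (Fin d → ℤ)) (c : SummandType)
    (α : Fin d → ℤ) (F : Set (Fin d → ℤ)) : IsSemigroupConvex Q (summandSupport Q c α F) := by
  intro β hβ a ha b hb h
  cases c with
  | injective =>
    obtain ⟨f, hf, q, hq, e⟩ := h
    exact ⟨f, hf, q + b, Q.add_mem hq hb, by rw [eq_sub_iff_add_eq] at e ⊢; rw [← e]; abel⟩
  | flat =>
    obtain ⟨f, hf, q, hq, rfl⟩ := hβ
    exact ⟨f, hf, q + a, Q.add_mem hq ha, by abel⟩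

section Decomposition

variable {k : Type u} [Field k] {d : ℕ} {Q : AddSubmonoid (Fin d → ℤ)}

/-- A decomposition of the graded module `J` as a finite direct sum of indecomposable injectives
`k{α_i + F_i - Q}` (if `c` is `injective`) or of modules `k{α_i - F_i + Q}` (if `c` is `flat`),
for faces `F_i` of `Q` and vectors `α_i ∈ ℤ^d`. -/
structure SummandDecomposition (c : SummandType) (J : ZGradedModule.{u, v} k Q) where
  r : ℕ
  face : Fin r → Set (Fin d → ℤ)
  isFace : ∀ i, IsFace Q (face i)
  vec : Fin r → (Fin d → ℤ)
  equiv : J.carrier ≃ₗ[AddMonoidAlgebra k Q]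
    (ZGradedModule.directSum fun i =>
      monomialModule k (summandSupport_convex Q c (vec i) (face i))).carrier
  isGraded : ZGradedModule.IsGradedHom J _ equiv.toLinearMap

/-- An injective module is one isomorphic to a finite direct sum of indecomposable injectives. -/
def ZGradedModule.IsInjective (J : ZGradedModule.{u, v} k Q) : Prop :=
  Nonempty (SummandDecomposition .injective J)

/-- A flat module is one isomorphic to a finite direct sum of Matlis duals `k{α - F + Q}` of
indecomposable injectives. -/
def ZGradedModule.IsFlat (J : ZGradedModule.{u, v} k Q) : Prop :=
  Nonempty (SummandDecomposition .flat J)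

namespace SummandDecomposition

variable {c : SummandType} {J' : ZGradedModule.{u, v'} k Q} {J : ZGradedModule.{u, v} k Q}
  {J'' : ZGradedModule.{u, v''} k Q}

/-- The set of degrees of the `i`-th summand. -/
def supp (D : SummandDecomposition c J) (i : Fin D.r) : Set (Fin d → ℤ) :=
  summandSupport Q c (D.vec i) (D.face i)

/-- The component of an element of `J` in the `i`-th summand `k{T_i}`. -/
noncomputable def component (D : SummandDecomposition c J) (i : Fin D.r) (z : J.carrier) :
    D.supp i →₀ k :=
  (show ∀ i, D.supp i →₀ k from D.equiv z) i

/-- The element `x^β` of the `i`-th summand of `J`. -/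
noncomputable def basisElement (D : SummandDecomposition c J) (i : Fin D.r) (β : D.supp i) :
    J.carrier :=
  D.equiv.symm (show ∀ i, D.supp i →₀ k from Pi.single i (Finsupp.single β 1))

open Classical in
/-- The set of (indices of) summands of `J` that are nonzero in degree `α`. -/
noncomputable def active (D : SummandDecomposition c J) (α : Fin d → ℤ) : Finset (Fin D.r) :=
  Finset.univ.filter fun i => α ∈ D.supp i

open Classical in
/-- The coordinate map `J_α → k^A`, sending the element `x^α` of the `i`-th summand to the basis
vector `e_i`, used when `A` is the set of summands nonzero in degree `α`. -/
noncomputable def coord (D : SummandDecomposition c J) (A : Finset (Fin D.r)) (α : Fin d → ℤ)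
    (z : J.carrier) : A → k :=
  fun i => if h : α ∈ D.supp i then D.component i z ⟨α, h⟩ else 0

/-- The condition on the scalar entries of a monomial matrix, with rows labelled by the summands
of `J'` and columns labelled by the summands of `J`. -/
def IsMonomialMatrix (D' : SummandDecomposition c J') (D : SummandDecomposition c J)
    (L : Matrix (Fin D'.r) (Fin D.r) k) : Prop :=
  match c with
  | .injective => ∀ q p, ¬ (D.face p ⊆ D'.face q ∧ D.vec p ∈ D'.supp q) → L q p = 0
  | .flat => ∀ q p, ¬ (D'.face q ⊆ D.face p ∧ D'.vec q ∈ D.supp p) → L q p = 0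

open Classical in
/-- The homomorphism `f : J' → J` is given by the monomial matrix `L`: its component from the
`q`-th summand of `J'` to the `p`-th summand of `J` takes `x^β` to `L q p • x^β` whenever `β` is a
degree of the latter summand, and to zero otherwise. -/
def Represents (D' : SummandDecomposition c J') (D : SummandDecomposition c J)
    (L : Matrix (Fin D'.r) (Fin D.r) k)
    (f : J'.carrier →ₗ[AddMonoidAlgebra k Q] J.carrier) : Prop :=
  D'.IsMonomialMatrix D L ∧ ∀ (q : Fin D'.r) (β : D'.supp q) (p : Fin D.r),
    D.component p (f (D'.basisElement q β)) =
      if h : (β : Fin d → ℤ) ∈ D.supp p then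
        Finsupp.single (⟨β, h⟩ : D.supp p) (L q p) else 0

/-- The set `S_{A',A,A''}` of degrees in which the nonzero summands of `J'`, `J`, `J''` are
precisely those indexed by `A'`, `A`, `A''`. -/
def sector (D' : SummandDecomposition c J') (D : SummandDecomposition c J)
    (D'' : SummandDecomposition c J'') (A' : Finset (Fin D'.r)) (A : Finset (Fin D.r))
    (A'' : Finset (Fin D''.r)) : Set (Fin d → ℤ) :=
  {α | D'.active α = A' ∧ D.active α = A ∧ D''.active α = A''}

end SummandDecomposition

end Decomposition

/-- The linear map `k^A → k^B` (acting on row vectors) given by the submatrix of `L` with rows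
in `A` and columns in `B`. -/
def submatrixMap {k : Type u} [Field k] {m n : ℕ} (L : Matrix (Fin m) (Fin n) k)
    (A : Finset (Fin m)) (B : Finset (Fin n)) : (A → k) →ₗ[k] (B → k) :=
  (L.submatrix (fun i : A => (i : Fin m)) (fun j : B => (j : Fin n))).vecMulLinear

/-- The kernel of the submatrix of `Ψ` modulo the image of the submatrix of `Φ`. -/
abbrev SubmatrixHomology {k : Type u} [Field k] {r' r r'' : ℕ} (Φ : Matrix (Fin r') (Fin r) k)
    (Ψ : Matrix (Fin r) (Fin r'') k) (A' : Finset (Fin r')) (A : Finset (Fin r))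
    (A'' : Finset (Fin r'')) : Type u :=
  LinearMap.ker (submatrixMap Ψ A A'') ⧸
    (LinearMap.range (submatrixMap Φ A' A)).comap (LinearMap.ker (submatrixMap Ψ A A'')).subtype

/-- The map `k^A → k^B` with `e_i ↦ e_i` if `i ∈ B` and `e_i ↦ 0` otherwise. -/
def restrictCoord {k : Type u} [Field k] {r : ℕ} (A B : Finset (Fin r)) (v : A → k) : B → k :=
  fun i => if h : (i : Fin r) ∈ A then v ⟨i, h⟩ else 0

/-! ## Sector partitions -/

/-- A sector partition of a `ℤ^d`-graded `k[Q]`-module `H`. -/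
structure SectorPartition {k : Type u} [Field k] {d : ℕ} {Q : AddSubmonoid (Fin d → ℤ)}
    (H : ZGradedModule.{u, w} k Q) where
  sectors : Set (Set (Fin d → ℤ))
  finite : sectors.Finite
  isPartition : Setoid.IsPartition sectors
  polyhedral : ∀ S ∈ sectors, IsPolyhedralRegion Q S
  /-- the vector spaces `H_S` -/
  space : sectors → Type u
  [addCommGroup : ∀ S, AddCommGroup (space S)]
  [module : ∀ S, Module k (space S)]
  [finiteDimensional : ∀ S, FiniteDimensional k (space S)]
  /-- the isomorphisms `H_α → H_S` -/
  iso : ∀ (S : sectors) (α : Fin d → ℤ), α ∈ S.1 → (H.deg α ≃ₗ[k] space S)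
  /-- the homomorphisms `x^(T-S) : H_S → H_T` -/
  map : ∀ S T : sectors, (∃ α ∈ S.1, ∃ β ∈ T.1, β - α ∈ Q) → (space S →ₗ[k] space T)
  comm : ∀ (S T : sectors) (α β : Fin d → ℤ) (hα : α ∈ S.1) (hβ : β ∈ T.1) (h : β - α ∈ Q)
    (x : H.deg α),
    map S T ⟨α, hα, β, hβ, h⟩ (iso S α hα x) = iso T β hβ (H.mulMonomial h x)

attribute [instance] SectorPartition.addCommGroup SectorPartition.module
  SectorPartition.finiteDimensional

section Complex

variable {k : Type u} [Field k] {d : ℕ} {Q : AddSubmonoid (Fin d → ℤ)}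
  {J' : ZGradedModule.{u, v'} k Q} {J : ZGradedModule.{u, v} k Q}
  {J'' : ZGradedModule.{u, v''} k Q} {H : ZGradedModule.{u, w} k Q}

/-- The middle homology `ker ψ / im φ` of `J' → J → J''`. -/
abbrev MiddleHomology (φ : J'.carrier →ₗ[AddMonoidAlgebra k Q] J.carrier)
    (ψ : J.carrier →ₗ[AddMonoidAlgebra k Q] J''.carrier) : Type v :=
  LinearMap.ker ψ ⧸ (LinearMap.range φ).comap (LinearMap.ker ψ).subtype

/-- The isomorphism `e` of modules from the middle homology `ker ψ / im φ` of `J' → J → J''` to `H`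
is homogeneous of degree `0`: classes of cycles of degree `α` are sent to `H_α`. -/
def IsGradedHomologyIso (φ : J'.carrier →ₗ[AddMonoidAlgebra k Q] J.carrier)
    (ψ : J.carrier →ₗ[AddMonoidAlgebra k Q] J''.carrier)
    (e : MiddleHomology φ ψ ≃ₗ[AddMonoidAlgebra k Q] H.carrier) : Prop :=
  ∀ (α : Fin d → ℤ) (z : LinearMap.ker ψ), (z : J.carrier) ∈ J.deg α →
    e (Submodule.Quotient.mk z) ∈ H.deg α

/-- The sector partition `P` of the middle homology `H` of `J' → J → J''` is the one computed from
the given decompositions of `J'`, `J`, `J''`: writing the maps by monomial matrices `Φ` and `Ψ`,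
* its sectors are the nonempty sets `S_{A',A,A''}`;
* its vector spaces are `ker(Ψ_A^{A''}) / im(Φ_{A'}^A)`, the isomorphisms `H_α ≅ H_S` being
  induced by the coordinate map `J_α → k^A`;
* its maps `x^(T-S)` are induced by the maps `k^A → k^B` with `e_i ↦ e_i` or `e_i ↦ 0`
  according to whether `i ∈ B` or not. -/
def SectorPartition.IsComputedBy {c : SummandType} (P : SectorPartition H)
    (φ : J'.carrier →ₗ[AddMonoidAlgebra k Q] J.carrier)
    (ψ : J.carrier →ₗ[AddMonoidAlgebra k Q] J''.carrier)
    (e : MiddleHomology φ ψ ≃ₗ[AddMonoidAlgebra k Q] H.carrier)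
    (D' : SummandDecomposition c J') (D : SummandDecomposition c J)
    (D'' : SummandDecomposition c J'') : Prop :=
  ∃ (Φ : Matrix (Fin D'.r) (Fin D.r) k) (Ψ : Matrix (Fin D.r) (Fin D''.r) k),
    D'.Represents D Φ φ ∧ D.Represents D'' Ψ ψ ∧
    P.sectors = {S | S.Nonempty ∧ ∃ A' A A'', S = D'.sector D D'' A' A A''} ∧
    ∃ θ : ∀ (A' : Finset (Fin D'.r)) (A : Finset (Fin D.r)) (A'' : Finset (Fin D''.r))
        (h : D'.sector D D'' A' A A'' ∈ P.sectors),
        P.space ⟨_, h⟩ ≃ₗ[k] SubmatrixHomology Φ Ψ A' A A'',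
      (∀ A' A A'' (h : D'.sector D D'' A' A A'' ∈ P.sectors) (α : Fin d → ℤ)
          (hα : α ∈ D'.sector D D'' A' A A'') (x : H.deg α) (z : LinearMap.ker ψ),
        (z : J.carrier) ∈ J.deg α → e (Submodule.Quotient.mk z) = x →
        ∃ hz : D.coord A α z ∈ LinearMap.ker (submatrixMap Ψ A A''),
          θ A' A A'' h (P.iso ⟨_, h⟩ α hα x) =
            Submodule.Quotient.mk ⟨D.coord A α z, hz⟩) ∧
      (∀ A' A A'' B' B B'' (hA : D'.sector D D'' A' A A'' ∈ P.sectors)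
          (hB : D'.sector D D'' B' B B'' ∈ P.sectors)
          (hAB : ∃ α ∈ D'.sector D D'' A' A A'', ∃ β ∈ D'.sector D D'' B' B B'', β - α ∈ Q)
          (y : LinearMap.ker (submatrixMap Ψ A A'')),
        ∃ hy : restrictCoord A B (y : A → k) ∈ LinearMap.ker (submatrixMap Ψ B B''),
          θ B' B B'' hB
              (P.map ⟨_, hA⟩ ⟨_, hB⟩ hAB ((θ A' A A'' hA).symm (Submodule.Quotient.mk y))) =
            Submodule.Quotient.mk ⟨restrictCoord A B (y : A → k), hy⟩)

end Complex

/-!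
The indecomposable modules `k{T}`, for `T = α + F - Q` or `T = α - F + Q`, are one-dimensional in
the degrees of `T`, and any two degrees of `T` have a common translate by `-Q`, respectively by
`Q`, in `T`. So a homomorphism `k{T'} → k{T}` is multiplication by one scalar on `T' ∩ T`, and this
scalar vanishes unless `T ⊆ T'`, respectively `T' ⊆ T` (`exists_scalar_of_summandSupport`), which
in terms of faces and vectors is the condition defining monomial matrices. In a degree `α` of
`S_{A',A,A''}`, the coordinates turn `J'_α → J_α → J''_α` into the submatrices of the monomial
matrices, whence `H_α ≅ ker (Ψ_A^{A''}) / im (Φ_{A'}^A)`, and multiplication by monomials becomes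
`e_i ↦ e_i` or `e_i ↦ 0` (`exists_deg_equiv_submatrixHomology`, `IsInducedByCoord.mulMonomial`).

That one sector partition serves all decompositions results from applying monomial matrices to the
identity of `J`. Two decompositions yield mutually inverse change of basis matrices; some product of
their entries is nonzero, and the vanishing condition then shows that both decompositions involve
the same sets `T` (`range_supp_eq`), so the sectors agree. The vector spaces for the two
decompositions are identified by a submatrix of the change of basis, which depends on the sector
only and not on the degree in it (`IsInducedByCoord.comp_symm_apply`). This matters because a sector
need not be connected under translation by elements of `Q`.

That the sectors are polyhedral rests on the facet description of the localization `Q - F`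
(`IsFace.exists_facetFunctionals`): it is finitely generated, saturated and spans `ℤ^d`, so Farkas'
lemma separates each point outside it by an integral functional, which can be rotated until its
zeros span a lattice of corank one. Membership in `T`, and so in a sector, is then decided by
finitely many inequalities `t x ≤ c` with `t` vanishing on a facet; over `ℤ` the negation of such
an inequality is `c + 1 ≤ t x`, which makes the cells disjoint closed polyhedra
(`isPolyhedralRegion_of_finset`).
-/

/-! ### Farkas' lemma and facet descriptions over `ℤ` -/

/-- Integral Farkas lemma, by induction on the number of generators: if `t` separates `a` from
all generators but `g`, one projects along `g` onto the hyperplane `t = 0`. -/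
theorem exists_separating_linearMap {d : ℕ} (l : List (Fin d → ℤ)) (a : Fin d → ℤ)
    (h : ∀ n : ℕ, 0 < n → n • a ∉ AddSubmonoid.closure {x | x ∈ l}) :
    ∃ t : (Fin d → ℤ) →ₗ[ℤ] ℤ, (∀ x ∈ l, 0 ≤ t x) ∧ t a < 0 := by
  generalize hn : l.length = n
  induction n generalizing l a with
  | zero =>
    obtain rfl := List.length_eq_zero_iff.1 hn
    have ha : a ≠ 0 := by
      rintro rfl
      exact h 1 one_pos (by simp)
    obtain ⟨j, hj⟩ := Function.ne_iff.1 ha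
    refine ⟨(-a j) • LinearMap.proj j, by simp, ?_⟩
    have : 0 < a j * a j := mul_self_pos.2 hj
    simpa using this
  | succ n ih =>
    obtain ⟨g, s, rfl⟩ := List.exists_cons_of_length_eq_add_one hn
    have hs : s.length = n := by simpa using hn
    have hg : g ∈ AddSubmonoid.closure {x | x ∈ g :: s} :=
      AddSubmonoid.subset_closure (by simp)
    have hmono : AddSubmonoid.closure {x | x ∈ s} ≤ AddSubmonoid.closure {x | x ∈ g :: s} :=
      AddSubmonoid.closure_mono fun x hx => List.mem_cons_of_mem _ hx
    obtain ⟨t, ht, hta⟩ := ih s a (fun n hn hc => h n hn (hmono hc)) hs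
    rcases le_or_gt 0 (t g) with hg0 | hg0
    · exact ⟨t, by simpa using ⟨hg0, ht⟩, hta⟩
    -- a positive multiple of the projection along `g` onto the kernel of `t`
    let p : (Fin d → ℤ) →ₗ[ℤ] (Fin d → ℤ) := (-t g) • LinearMap.id + t.smulRight g
    have hp : ∀ x, p x = (-t g) • x + t x • g := fun x => by simp [p]
    obtain ⟨m, hm⟩ := Int.eq_ofNat_of_zero_le (neg_pos.2 hg0).le
    have hm0 : 0 < m := by omega
    have key : AddSubmonoid.closure {x | x ∈ s.map p} ≤ AddSubmonoid.closure {x | x ∈ g :: s} := by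
      refine AddSubmonoid.closure_le.2 fun z hz => ?_
      obtain ⟨x, hx, rfl⟩ := List.mem_map.1 hz
      obtain ⟨c, hc⟩ := Int.eq_ofNat_of_zero_le (ht x hx)
      rw [hp, hm, hc]
      simp only [natCast_zsmul]
      exact add_mem (nsmul_mem (hmono (AddSubmonoid.subset_closure hx)) _) (nsmul_mem hg _)
    obtain ⟨u, hu, hua⟩ := ih (s.map p) (p a) (fun n hn hc => by
      have h1 := key hc
      obtain ⟨c, hc'⟩ := Int.eq_ofNat_of_zero_le (neg_pos.2 hta).le
      refine h (n * m) (Nat.mul_pos hn hm0) ?_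
      have e : (n * m) • a = n • p a + (n * c) • g := by
        have h2 : t a = -(c : ℤ) := by omega
        rw [hp, hm, h2, smul_add, mul_smul, mul_smul]
        simp only [neg_smul, natCast_zsmul, smul_neg]
        abel
      rw [e]
      exact add_mem h1 (nsmul_mem hg _)) (by simpa using hs)
    refine ⟨u ∘ₗ p, ?_, hua⟩
    intro x hx
    rcases List.mem_cons.1 hx with rfl | hx
    · simp [hp]
    · exact hu _ (List.mem_map_of_mem hx)

theorem exists_linearMap_ne_zero_of_finrank_lt {d : ℕ} (N : Submodule ℤ (Fin d → ℤ))
    (h : Module.finrank ℤ N < d) : ∃ s : (Fin d → ℤ) →ₗ[ℤ] ℤ, s ≠ 0 ∧ ∀ x ∈ N, s x = 0 := by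
  by_contra! hc
  let R : Module.Dual ℤ (Fin d → ℤ) →ₗ[ℤ] Module.Dual ℤ N := N.subtype.dualMap
  have hinj : Function.Injective R := by
    rw [injective_iff_map_eq_zero]
    intro s hs
    by_contra hs0
    obtain ⟨x, hx, hx0⟩ := hc s hs0
    exact hx0 (LinearMap.congr_fun hs ⟨x, hx⟩)
  have := LinearMap.finrank_le_finrank_of_injective hinj
  simp [Module.Dual, Module.finrank_linearMap_self] at this
  omega

theorem finrank_lt_of_le_ker {d : ℕ} (N : Submodule ℤ (Fin d → ℤ)) (t : (Fin d → ℤ) →ₗ[ℤ] ℤ)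
    (ht : t ≠ 0) (h : N ≤ LinearMap.ker t) : Module.finrank ℤ N < d := by
  have h1 : Module.finrank ℤ (LinearMap.range t) + Module.finrank ℤ (LinearMap.ker t) = d := by
    have := Submodule.finrank_quotient_add_finrank (LinearMap.ker t)
    rwa [t.quotKerEquivRange.finrank_eq, Module.finrank_fin_fun] at this
  have h2 : Module.finrank ℤ N ≤ Module.finrank ℤ (LinearMap.ker t) := Submodule.finrank_mono h
  have h3 : 0 < Module.finrank ℤ (LinearMap.range t) := by
    rw [Module.finrank_pos_iff, ← not_subsingleton_iff_nontrivial]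
    rw [Submodule.subsingleton_iff_eq_bot, LinearMap.range_eq_bot]
    exact ht
  omega

theorem finrank_sup_add_finrank_inf_eq_int {d : ℕ} (M N : Submodule ℤ (Fin d → ℤ)) :
    Module.finrank ℤ (M ⊔ N : Submodule ℤ (Fin d → ℤ)) +
      Module.finrank ℤ (M ⊓ N : Submodule ℤ (Fin d → ℤ)) =
      Module.finrank ℤ M + Module.finrank ℤ N := by
  have := Submodule.rank_sup_add_rank_inf_eq M N
  rw [← Module.finrank_eq_rank, ← Module.finrank_eq_rank, ← Module.finrank_eq_rank,
    ← Module.finrank_eq_rank] at this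
  exact_mod_cast this

theorem finrank_span_insert_le {d : ℕ} (s : Set (Fin d → ℤ)) (a : Fin d → ℤ) :
    Module.finrank ℤ (Submodule.span ℤ (insert a s)) ≤
      Module.finrank ℤ (Submodule.span ℤ s) + 1 := by
  have h := finrank_sup_add_finrank_inf_eq_int (Submodule.span ℤ {a}) (Submodule.span ℤ s)
  have h1 : Module.finrank ℤ (Submodule.span ℤ {a}) ≤ 1 :=
    (finrank_span_le_card _).trans (by simp)
  rw [Submodule.span_insert]
  omega

/-- A functional separating `a` from a cone can be taken to define a facet of it: as long as its
zeros among the generators span too small a lattice, rotating it, with its value at `a` fixed up to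
a positive factor, makes it vanish on more generators. -/
theorem exists_facet_linearMap_of_separating {d : ℕ} (G : Finset (Fin d → ℤ))
    (hG : Submodule.span ℤ (G : Set (Fin d → ℤ)) = ⊤) (a : Fin d → ℤ)
    (t : (Fin d → ℤ) →ₗ[ℤ] ℤ) (ht : ∀ g ∈ G, 0 ≤ t g) (hta : t a < 0) :
    ∃ t : (Fin d → ℤ) →ₗ[ℤ] ℤ, (∀ g ∈ G, 0 ≤ t g) ∧ t a < 0 ∧
      Module.finrank ℤ (Submodule.span ℤ {g | g ∈ G ∧ t g = 0}) + 1 = d := by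
  classical
  generalize hn : (G.filter fun g => t g ≠ 0).card = n
  induction n using Nat.strong_induction_on generalizing t with
  | _ n ih =>
  subst hn
  have ht0 : t ≠ 0 := by rintro rfl; simp at hta
  have hker : Submodule.span ℤ {g | g ∈ G ∧ t g = 0} ≤ LinearMap.ker t :=
    Submodule.span_le.2 fun g hg => hg.2
  have hlt := finrank_lt_of_le_ker _ t ht0 hker
  by_cases hd : Module.finrank ℤ (Submodule.span ℤ {g | g ∈ G ∧ t g = 0}) + 1 = d
  · exact ⟨t, ht, hta, hd⟩
  obtain ⟨s, hs0, hs⟩ := exists_linearMap_ne_zero_of_finrank_lt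
    (Submodule.span ℤ (insert a {g | g ∈ G ∧ t g = 0}))
    (lt_of_le_of_lt (finrank_span_insert_le _ _) (by omega))
  -- a functional `s` that is negative on some generator and vanishes at `a` and where `t` does
  obtain ⟨s, ⟨g₁, hg₁, hsg₁⟩, hsa, hsz⟩ : ∃ s : (Fin d → ℤ) →ₗ[ℤ] ℤ,
      (∃ g ∈ G, s g < 0) ∧ s a = 0 ∧ ∀ g ∈ G, t g = 0 → s g = 0 := by
    have h1 : s a = 0 := hs a (Submodule.subset_span (by simp))
    have h2 : ∀ g ∈ G, t g = 0 → s g = 0 := fun g hg h =>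
      hs g (Submodule.subset_span (by simp [hg, h]))
    have h3 : ∃ g ∈ G, s g ≠ 0 := by
      by_contra! hc
      apply hs0
      rw [← LinearMap.ker_eq_top, eq_top_iff, ← hG]
      exact Submodule.span_le.2 hc
    obtain ⟨g, hg, hsg⟩ := h3
    rcases hsg.lt_or_gt with h | h
    · exact ⟨s, ⟨g, hg, h⟩, h1, h2⟩
    · exact ⟨-s, ⟨g, hg, by simpa using h⟩, by simpa using h1, by simpa using h2⟩
  -- move from `t` in the direction of `s` until a further generator is annihilated
  obtain ⟨g₀, hg₀, hmin⟩ := (G.filter fun g => s g < 0).exists_min_image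
    (fun g => (t g : ℚ) / (-s g : ℚ)) ⟨g₁, by simp [hg₁, hsg₁]⟩
  simp only [Finset.mem_filter] at hg₀ hmin
  obtain ⟨hg₀G, hsg₀⟩ := hg₀
  have htg₀ : 0 < t g₀ := lt_of_le_of_ne (ht _ hg₀G) fun h => by
    have := hsz _ hg₀G h.symm; omega
  let t' : (Fin d → ℤ) →ₗ[ℤ] ℤ := (-s g₀) • t + t g₀ • s
  have ht' : ∀ x, t' x = (-s g₀) * t x + t g₀ * s x := fun x => by simp [t']
  refine ih _ (Finset.card_lt_card ?_) t' ?_ ?_ rfl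
  · rw [Finset.ssubset_iff_of_subset]
    · refine ⟨g₀, by simp [hg₀G, htg₀.ne'], ?_⟩
      simp only [Finset.mem_filter, not_and, not_not]
      intro _
      rw [ht']; ring
    · intro g
      simp only [Finset.mem_filter]
      rintro ⟨hg, h⟩
      refine ⟨hg, fun h0 => h ?_⟩
      rw [ht', h0, hsz g hg h0]; simp
  · intro g hg
    rw [ht']
    rcases le_or_gt 0 (s g) with h | h
    · have := ht g hg
      have := mul_nonneg (neg_pos.2 hsg₀).le this
      have := mul_nonneg htg₀.le h
      linarith
    · have h1 := hmin g ⟨hg, h⟩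
      have e1 : (0 : ℚ) < -s g₀ := by exact_mod_cast neg_pos.2 hsg₀
      have e2 : (0 : ℚ) < -s g := by exact_mod_cast neg_pos.2 h
      rw [div_le_div_iff₀ e1 e2] at h1
      have h2 : t g₀ * (-s g) ≤ t g * (-s g₀) := by exact_mod_cast h1
      linarith
  · rw [ht', hsa]
    have := mul_pos (neg_pos.2 hsg₀) (neg_pos.2 hta)
    linarith

/-- Two functionals that are nonnegative on a spanning set and whose common zeros there span a
sublattice of corank one differ by a positive factor, so they are negative at the same points. -/
theorem neg_of_neg_of_same_zeros {d : ℕ} (G : Finset (Fin d → ℤ))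
    (hG : Submodule.span ℤ (G : Set (Fin d → ℤ)) = ⊤)
    (t t' : (Fin d → ℤ) →ₗ[ℤ] ℤ) (ht : ∀ g ∈ G, 0 ≤ t g) (ht' : ∀ g ∈ G, 0 ≤ t' g)
    (h0 : ∀ g ∈ G, t g = 0 ↔ t' g = 0)
    (hrk : Module.finrank ℤ (Submodule.span ℤ {g | g ∈ G ∧ t g = 0}) + 1 = d)
    (a : Fin d → ℤ) (ha : t a < 0) : t' a < 0 := by
  have hne : ∃ g ∈ G, t g ≠ 0 := by
    by_contra! hc
    have : t = 0 := by
      rw [← LinearMap.ker_eq_top, eq_top_iff, ← hG]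
      exact Submodule.span_le.2 hc
    simp [this] at ha
  obtain ⟨g, hg, hgt⟩ := hne
  have h1 : 0 < t g := lt_of_le_of_ne (ht g hg) (Ne.symm hgt)
  have h2 : 0 < t' g := lt_of_le_of_ne (ht' g hg) (Ne.symm fun h => hgt ((h0 g hg).2 h))
  let u : (Fin d → ℤ) →ₗ[ℤ] ℤ := t' g • t - t g • t'
  have hu : ∀ x, u x = t' g * t x - t g * t' x := fun x => by simp [u]
  have hu0 : u = 0 := by
    by_contra hu0
    -- the span of the common zeros and of `g` has full rank, and `u` vanishes on it
    have hlt := finrank_lt_of_le_ker (Submodule.span ℤ (insert g {g | g ∈ G ∧ t g = 0})) u hu0 (by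
      refine Submodule.span_le.2 ?_
      rintro x (rfl | ⟨hx, hx0⟩)
      · simp [hu]; ring
      · simp [hu, hx0, (h0 x hx).1 hx0])
    have hinf : Submodule.span ℤ {g} ⊓ Submodule.span ℤ {g | g ∈ G ∧ t g = 0} = ⊥ := by
      rw [eq_bot_iff]
      rintro x ⟨hx1, hx2⟩
      obtain ⟨c, rfl⟩ := Submodule.mem_span_singleton.1 hx1
      have h3 : t (c • g) = 0 :=
        (Submodule.span_le.2 (fun g hg => hg.2) :
          Submodule.span ℤ {g | g ∈ G ∧ t g = 0} ≤ LinearMap.ker t) hx2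
      rw [map_smul, smul_eq_mul, mul_eq_zero] at h3
      have : c = 0 := h3.resolve_right hgt
      simp [this]
    have h4 := finrank_sup_add_finrank_inf_eq_int (Submodule.span ℤ {g})
      (Submodule.span ℤ {g | g ∈ G ∧ t g = 0})
    have h5 : 0 < Module.finrank ℤ (Submodule.span ℤ {g}) := by
      rw [Module.finrank_pos_iff, ← not_subsingleton_iff_nontrivial,
        Submodule.subsingleton_iff_eq_bot, Submodule.span_singleton_eq_bot]
      rintro rfl
      simp at hgt
    rw [hinf, ← Submodule.span_insert, finrank_bot] at h4
    omega
  have h3 : t' g * t a = t g * t' a := by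
    have := hu a
    rw [hu0] at this
    simp at this; linarith
  have : t g * t' a < 0 := h3 ▸ mul_neg_of_pos_of_neg h2 ha
  exact (pos_iff_neg_of_mul_neg this).1 h1

/-- A saturated finitely generated submonoid spanning `ℤ^d` is cut out by finitely many functionals
defining facets; one functional is chosen for each possible set of generators on a facet. -/
theorem exists_finset_facet_linearMap {d : ℕ} (G : Finset (Fin d → ℤ))
    (hG : Submodule.span ℤ (G : Set (Fin d → ℤ)) = ⊤)
    (hsat : ∀ (n : ℕ) (a : Fin d → ℤ), n ≠ 0 → n • a ∈ AddSubmonoid.closure (G : Set (Fin d → ℤ)) →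
      a ∈ AddSubmonoid.closure (G : Set (Fin d → ℤ))) :
    ∃ N : Finset ((Fin d → ℤ) →ₗ[ℤ] ℤ), (∀ t ∈ N, t ≠ 0 ∧ (∀ g ∈ G, 0 ≤ t g) ∧
        Module.finrank ℤ (Submodule.span ℤ {g | g ∈ G ∧ t g = 0}) + 1 = d) ∧
      ∀ a, a ∈ AddSubmonoid.closure (G : Set (Fin d → ℤ)) ↔ ∀ t ∈ N, 0 ≤ t a := by
  classical
  let P : Finset (Fin d → ℤ) → ((Fin d → ℤ) →ₗ[ℤ] ℤ) → Prop := fun Z t =>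
    t ≠ 0 ∧ (∀ g ∈ G, 0 ≤ t g) ∧
      Module.finrank ℤ (Submodule.span ℤ {g | g ∈ G ∧ t g = 0}) + 1 = d ∧
      ∀ g ∈ G, t g = 0 ↔ g ∈ Z
  let f : Finset (Fin d → ℤ) → ((Fin d → ℤ) →ₗ[ℤ] ℤ) := fun Z => Classical.epsilon (P Z)
  have hf : ∀ Z t, P Z t → P Z (f Z) := fun Z t h => Classical.epsilon_spec ⟨t, h⟩
  refine ⟨(G.powerset.filter fun Z => ∃ t, P Z t).image f, ?_, fun a => ⟨?_, ?_⟩⟩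
  · intro t ht
    obtain ⟨Z, hZ, rfl⟩ := Finset.mem_image.1 ht
    obtain ⟨t, h⟩ := (Finset.mem_filter.1 hZ).2
    obtain ⟨h1, h2, h3, -⟩ := hf Z t h
    exact ⟨h1, h2, h3⟩
  · intro ha t ht
    obtain ⟨Z, hZ, rfl⟩ := Finset.mem_image.1 ht
    obtain ⟨t, h⟩ := (Finset.mem_filter.1 hZ).2
    obtain ⟨-, h2, -⟩ := hf Z t h
    have : AddSubmonoid.closure (G : Set (Fin d → ℤ)) ≤
        (AddSubmonoid.nonneg ℤ).comap (f Z).toAddMonoidHom :=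
      AddSubmonoid.closure_le.2 h2
    exact this ha
  · intro h
    by_contra ha
    have hl : {x | x ∈ G.toList} = (G : Set (Fin d → ℤ)) := by ext; simp
    obtain ⟨t, ht, hta⟩ := exists_separating_linearMap G.toList a (by
      intro n hn hc
      rw [hl] at hc
      exact ha (hsat n a hn.ne' hc))
    obtain ⟨t, ht, hta, hrk⟩ := exists_facet_linearMap_of_separating G hG a t (by simpa using ht) hta
    have hP : P (G.filter fun g => t g = 0) t := by
      refine ⟨?_, ht, hrk, fun g hg => by simp [hg]⟩
      rintro rfl
      simp at hta
    obtain ⟨-, h2, -, h4⟩ := hf _ _ hP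
    have hneg := neg_of_neg_of_same_zeros G hG t _ ht h2
      (fun g hg => by rw [h4 g hg]; simp [hg]) hrk a hta
    refine hneg.not_ge (h _ (Finset.mem_image_of_mem _ ?_))
    simp only [Finset.mem_filter, Finset.mem_powerset]
    exact ⟨Finset.filter_subset _ _, t, hP⟩

/-! ### Faces and their localizations -/

section Faces

variable {d : ℕ} {Q : AddSubmonoid (Fin d → ℤ)} {F : Set (Fin d → ℤ)}

/-- The minimum over `Q` of a functional defining a face is `0`. -/
theorem IsFace.exists_nonneg (hF : IsFace Q F) : ∃ l : (Fin d → ℤ) →+ ℝ,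
    (∀ b ∈ Q, 0 ≤ l b) ∧ ∀ a, a ∈ F ↔ a ∈ Q ∧ l a = 0 := by
  obtain ⟨⟨f, hf⟩, l, rfl⟩ := hF
  have h0 : l f = 0 := by
    have h1 := hf.2 0 Q.zero_mem
    have h2 := hf.2 (f + f) (Q.add_mem hf.1 hf.1)
    simp only [map_zero, map_add] at h1 h2
    linarith
  have hnn : ∀ b ∈ Q, 0 ≤ l b := fun b hb => h0 ▸ hf.2 b hb
  refine ⟨l, hnn, fun a => ⟨fun ha => ⟨ha.1, ?_⟩, fun ha => ⟨ha.1, fun b hb => ?_⟩⟩⟩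
  · exact le_antisymm (h0 ▸ ha.2 f hf.1) (hnn a ha.1)
  · rw [ha.2]; exact hnn b hb

theorem IsFace.subset (hF : IsFace Q F) : F ⊆ Q := by
  obtain ⟨l, -, h⟩ := hF.exists_nonneg
  exact fun a ha => ((h a).1 ha).1

theorem IsFace.zero_mem (hF : IsFace Q F) : (0 : Fin d → ℤ) ∈ F := by
  obtain ⟨l, -, h⟩ := hF.exists_nonneg
  exact (h 0).2 ⟨Q.zero_mem, map_zero l⟩

theorem IsFace.add_mem (hF : IsFace Q F) {a b : Fin d → ℤ} (ha : a ∈ F) (hb : b ∈ F) :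
    a + b ∈ F := by
  obtain ⟨l, -, h⟩ := hF.exists_nonneg
  rw [h] at ha hb ⊢
  exact ⟨Q.add_mem ha.1 hb.1, by rw [map_add, ha.2, hb.2, add_zero]⟩

/-- The localization `Q - F` of `Q` along the face `F`. -/
def IsFace.localization (hF : IsFace Q F) : AddSubmonoid (Fin d → ℤ) where
  carrier := {x | ∃ f ∈ F, ∃ q ∈ Q, x = q - f}
  zero_mem' := ⟨0, hF.zero_mem, 0, Q.zero_mem, by simp⟩
  add_mem' := by
    rintro _ _ ⟨f, hf, q, hq, rfl⟩ ⟨f', hf', q', hq', rfl⟩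
    exact ⟨f + f', hF.add_mem hf hf', q + q', Q.add_mem hq hq', by abel⟩

theorem IsFace.mem_localization (hF : IsFace Q F) {x : Fin d → ℤ} :
    x ∈ hF.localization ↔ ∃ f ∈ F, ∃ q ∈ Q, x = q - f := Iff.rfl

theorem IsFace.le_localization (hF : IsFace Q F) : Q ≤ hF.localization :=
  fun q hq => ⟨0, hF.zero_mem, q, hq, by simp⟩

theorem IsFace.neg_mem_localization (hF : IsFace Q F) {f : Fin d → ℤ} (hf : f ∈ F) :
    -f ∈ hF.localization :=
  ⟨f, hf, 0, Q.zero_mem, by simp⟩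

theorem IsFace.localization_saturated (hQ : IsNormalAffineSemigroup Q) (hF : IsFace Q F)
    (n : ℕ) (a : Fin d → ℤ) (hn : n ≠ 0) (h : n • a ∈ hF.localization) : a ∈ hF.localization := by
  obtain ⟨f, hf, q, hq, e⟩ := h
  refine ⟨f, hf, a + f, hQ.saturated n _ hn ?_, by abel⟩
  obtain ⟨m, rfl⟩ := Nat.exists_eq_succ_of_ne_zero hn
  have : (m + 1) • (a + f) = q + m • f := by
    rw [smul_add, e, succ_nsmul f]; abel
  rw [Nat.succ_eq_add_one, this]
  exact Q.add_mem hq (Q.nsmul_mem (hF.subset hf) _)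

theorem IsFace.exists_closure_eq_localization (hQ : IsNormalAffineSemigroup Q) (hF : IsFace Q F) :
    ∃ G : Finset (Fin d → ℤ), AddSubmonoid.closure (G : Set (Fin d → ℤ)) = hF.localization := by
  classical
  obtain ⟨G, hG⟩ := hQ.fg
  obtain ⟨l, hl, hlF⟩ := hF.exists_nonneg
  have hGQ : ∀ g ∈ G, g ∈ Q := fun g hg => hG ▸ AddSubmonoid.subset_closure hg
  let G' := G ∪ (G.filter fun g => g ∈ F).image (fun g => -g)
  have hGG' : (G : Set (Fin d → ℤ)) ⊆ (G' : Set (Fin d → ℤ)) := by simp [G']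
  refine ⟨G', le_antisymm (AddSubmonoid.closure_le.2 ?_) ?_⟩
  · intro g hg
    have hg' : g ∈ G' := hg
    simp only [G', Finset.mem_union, Finset.mem_image, Finset.mem_filter] at hg'
    rcases hg' with h | ⟨f, ⟨-, hf⟩, rfl⟩
    · exact hF.le_localization (hGQ g h)
    · exact hF.neg_mem_localization hf
  · have hQle : Q ≤ AddSubmonoid.closure (G' : Set (Fin d → ℤ)) := by
      rw [← hG]; exact AddSubmonoid.closure_mono hGG'
    rintro _ ⟨f, hf, q, hq, rfl⟩
    rw [sub_eq_add_neg]
    refine AddSubmonoid.add_mem _ (hQle hq) ?_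
    have hfG : f ∈ AddSubmonoid.closure (G : Set (Fin d → ℤ)) := hG ▸ hF.subset hf
    have key : l f = 0 → -f ∈ AddSubmonoid.closure (G' : Set (Fin d → ℤ)) := by
      induction hfG using AddSubmonoid.closure_induction with
      | mem g hg =>
        intro h0
        refine AddSubmonoid.subset_closure ?_
        have : g ∈ F := (hlF g).2 ⟨hGQ g hg, h0⟩
        simp only [G', Finset.coe_union, Finset.coe_image, Finset.coe_filter]
        exact Or.inr ⟨g, ⟨hg, this⟩, rfl⟩
      | zero => simp
      | add x y hx hy ihx ihy =>
        rw [hG] at hx hy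
        intro h0
        rw [map_add] at h0
        have h1 := hl x hx
        have h2 := hl y hy
        have hx0 : l x = 0 := by linarith
        have hy0 : l y = 0 := by linarith
        rw [neg_add]
        exact AddSubmonoid.add_mem _ (ihx ((hlF x).2 ⟨hx, hx0⟩) hx0) (ihy ((hlF y).2 ⟨hy, hy0⟩) hy0)
    exact key ((hlF f).1 hf).2

theorem IsNormalAffineSemigroup.exists_sub (hQ : IsNormalAffineSemigroup Q) (x : Fin d → ℤ) :
    ∃ a ∈ Q, ∃ b ∈ Q, x = a - b := by
  have hx : x ∈ AddSubgroup.closure (Q : Set (Fin d → ℤ)) := by rw [hQ.generates]; trivial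
  induction hx using AddSubgroup.closure_induction with
  | mem x hx => exact ⟨x, hx, 0, Q.zero_mem, by simp⟩
  | zero => exact ⟨0, Q.zero_mem, 0, Q.zero_mem, by simp⟩
  | add x y _ _ hx hy =>
    obtain ⟨a, ha, b, hb, rfl⟩ := hx
    obtain ⟨a', ha', b', hb', rfl⟩ := hy
    exact ⟨a + a', Q.add_mem ha ha', b + b', Q.add_mem hb hb', by abel⟩
  | neg x _ hx =>
    obtain ⟨a, ha, b, hb, rfl⟩ := hx
    exact ⟨b, hb, a, ha, by abel⟩

variable (Q) in
/-- A nonzero integral functional that vanishes on a facet of `Q`. -/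
def IsFacetFunctional (t : (Fin d → ℤ) →ₗ[ℤ] ℤ) : Prop :=
  t ≠ 0 ∧ ∃ F, IsFacet Q F ∧ ∀ a ∈ F, t a = 0

/-- The localization of `Q` along a face is cut out by functionals vanishing on facets. -/
theorem IsFace.exists_facetFunctionals (hQ : IsNormalAffineSemigroup Q) (hF : IsFace Q F) :
    ∃ N : Finset ((Fin d → ℤ) →ₗ[ℤ] ℤ), (∀ t ∈ N, IsFacetFunctional Q t) ∧
      ∀ x, x ∈ hF.localization ↔ ∀ t ∈ N, 0 ≤ t x := by
  obtain ⟨G, hG⟩ := hF.exists_closure_eq_localization hQ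
  have hGM : ∀ g ∈ G, g ∈ hF.localization := fun g hg => hG ▸ AddSubmonoid.subset_closure hg
  have hspan : Submodule.span ℤ (G : Set (Fin d → ℤ)) = ⊤ := by
    rw [eq_top_iff]
    have hle : hF.localization ≤ (Submodule.span ℤ (G : Set (Fin d → ℤ))).toAddSubmonoid := by
      rw [← hG]; exact AddSubmonoid.closure_le.2 Submodule.subset_span
    intro x _
    obtain ⟨a, ha, b, hb, rfl⟩ := hQ.exists_sub x
    exact sub_mem (hle (hF.le_localization ha)) (hle (hF.le_localization hb))
  obtain ⟨N, hN, hmem⟩ := exists_finset_facet_linearMap G hspan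
    (by rw [hG]; exact hF.localization_saturated hQ)
  rw [hG] at hmem
  refine ⟨N, fun t ht => ?_, hmem⟩
  obtain ⟨ht0, -, hrk⟩ := hN t ht
  have htM : ∀ x ∈ hF.localization, 0 ≤ t x := fun x hx => (hmem x).1 hx t ht
  have htQ : ∀ x ∈ Q, 0 ≤ t x := fun x hx => htM x (hF.le_localization hx)
  have htF : ∀ f ∈ F, t f = 0 := fun f hf => by
    have h1 := htQ f (hF.subset hf)
    have h2 := htM _ (hF.neg_mem_localization hf)
    rw [map_neg] at h2
    omega
  refine ⟨ht0, {a | a ∈ Q ∧ t a = 0}, ⟨⟨⟨0, Q.zero_mem, map_zero t⟩,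
    (Int.castAddHom ℝ).comp t.toAddMonoidHom, ?_⟩, ?_⟩, fun a ha => ha.2⟩
  · ext a
    simp only [Set.mem_ofPred_eq, AddMonoidHom.coe_comp, Function.comp_apply, Int.coe_castAddHom,
      LinearMap.toAddMonoidHom_coe, Int.cast_le]
    refine and_congr_right fun ha => ⟨fun h b hb => h ▸ htQ b hb, fun h => ?_⟩
    exact le_antisymm (by simpa using h 0 Q.zero_mem) (htQ a ha)
  · -- the facet spans the corank one lattice spanned by the zeros of `t` among the generators
    have h1 : Submodule.span ℤ {g | g ∈ G ∧ t g = 0} ≤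
        Submodule.span ℤ {a | a ∈ Q ∧ t a = 0} := by
      refine Submodule.span_le.2 ?_
      rintro g ⟨hg, hg0⟩
      obtain ⟨f, hf, q, hq, rfl⟩ := hGM g hg
      rw [map_sub, htF f hf, sub_zero] at hg0
      exact sub_mem (Submodule.subset_span ⟨hq, hg0⟩)
        (Submodule.subset_span ⟨hF.subset hf, htF f hf⟩)
    have h2 := Submodule.finrank_mono h1
    have h3 := finrank_lt_of_le_ker (Submodule.span ℤ {a | a ∈ Q ∧ t a = 0}) t ht0
      (Submodule.span_le.2 fun a ha => ha.2)
    omega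

end Faces

/-! ### Polyhedral regions -/

section Polyhedra

variable {d : ℕ} {Q : AddSubmonoid (Fin d → ℤ)}

/-- The extension to `ℝ^d` of an integral functional on `ℤ^d`. -/
def realExtension (t : (Fin d → ℤ) →ₗ[ℤ] ℤ) (x : Fin d → ℝ) : ℝ :=
  ∑ j, (t (Pi.single j 1) : ℝ) * x j

theorem linearMap_eq_sum (t : (Fin d → ℤ) →ₗ[ℤ] ℤ) (a : Fin d → ℤ) :
    t a = ∑ j, t (Pi.single j 1) * a j := by
  rw [LinearMap.pi_apply_eq_sum_univ t a]
  refine Finset.sum_congr rfl fun j _ => ?_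
  rw [smul_eq_mul, mul_comm]
  congr 2
  ext i
  simp [Pi.single_apply, eq_comm]

theorem realExtension_intCast (t : (Fin d → ℤ) →ₗ[ℤ] ℤ) (a : Fin d → ℤ) :
    realExtension t (fun j => (a j : ℝ)) = (t a : ℝ) := by
  rw [linearMap_eq_sum t a, realExtension]
  push_cast
  rfl

theorem IsFacetFunctional.neg {t : (Fin d → ℤ) →ₗ[ℤ] ℤ} (ht : IsFacetFunctional Q t) :
    IsFacetFunctional Q (-t) := by
  obtain ⟨h0, F, hF, h⟩ := ht
  exact ⟨neg_ne_zero.2 h0, F, hF, fun a ha => by simp [h a ha]⟩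

theorem IsFacetFunctional.isFacetHalfSpace {t : (Fin d → ℤ) →ₗ[ℤ] ℤ}
    (ht : IsFacetFunctional Q t) (c : ℤ) :
    IsFacetHalfSpace Q {x | realExtension t x ≤ c} := by
  obtain ⟨h0, F, hF, h⟩ := ht
  refine ⟨F, fun j => t (Pi.single j 1), c, hF, ?_, ?_, ?_⟩
  · intro hc
    apply h0
    ext j
    simpa using congrFun hc j
  · intro a ha
    rw [← linearMap_eq_sum, h a ha]
  · simp [realExtension]

/-- A set of lattice points that is a union of classes of the equivalence relation "on the same
side of finitely many hyperplanes parallel to facets" is polyhedral: as the lattice points not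
satisfying `t x ≤ c` satisfy `c + 1 ≤ t x`, the classes are the lattice points of pairwise disjoint
closed polyhedra. -/
theorem isPolyhedralRegion_of_finset (K : Finset (((Fin d → ℤ) →ₗ[ℤ] ℤ) × ℤ))
    (hK : ∀ p ∈ K, IsFacetFunctional Q p.1) (S : Set (Fin d → ℤ))
    (hS : ∀ a ∈ S, ∀ b, (∀ p ∈ K, p.1 a ≤ p.2 ↔ p.1 b ≤ p.2) → b ∈ S) :
    IsPolyhedralRegion Q S := by
  classical
  let side : Finset (((Fin d → ℤ) →ₗ[ℤ] ℤ) × ℤ) → ((Fin d → ℤ) →ₗ[ℤ] ℤ) × ℤ →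
      Set (Fin d → ℝ) := fun σ p =>
    if p ∈ σ then {x | realExtension p.1 x ≤ p.2}
    else {x | realExtension (-p.1) x ≤ (-p.2 - 1 : ℤ)}
  let cell : Finset (((Fin d → ℤ) →ₗ[ℤ] ℤ) × ℤ) → Set (Fin d → ℝ) :=
    fun σ => ⋂₀ (side σ '' K)
  let sign : (Fin d → ℤ) → Finset (((Fin d → ℤ) →ₗ[ℤ] ℤ) × ℤ) :=
    fun a => K.filter fun p => p.1 a ≤ p.2
  have hneg : ∀ (t : (Fin d → ℤ) →ₗ[ℤ] ℤ) x, realExtension (-t) x = -realExtension t x := by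
    intro t x
    simp [realExtension]
  have hmem : ∀ a b : Fin d → ℤ, (fun j => (b j : ℝ)) ∈ cell (sign a) →
      ∀ p ∈ K, p.1 a ≤ p.2 ↔ p.1 b ≤ p.2 := by
    intro a b hb p hp
    have h := hb _ ⟨p, hp, rfl⟩
    by_cases hpa : p.1 a ≤ p.2
    · simp only [side, sign, Finset.mem_filter, hp, hpa, and_self, if_true, Set.mem_ofPred_eq,
        realExtension_intCast, Int.cast_le] at h
      simp [hpa, h]
    · simp only [side, sign, Finset.mem_filter, hp, hpa, and_false, if_false, Set.mem_ofPred_eq,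
        realExtension_intCast, Int.cast_le, LinearMap.neg_apply] at h
      simp only [hpa, false_iff]
      omega
  have hself : ∀ a : Fin d → ℤ, (fun j => (a j : ℝ)) ∈ cell (sign a) := by
    rintro a _ ⟨p, hp, rfl⟩
    rw [Finset.mem_coe] at hp
    by_cases hpa : p.1 a ≤ p.2
    · simp only [side, sign, Finset.mem_filter, hp, hpa, and_self, if_true, Set.mem_ofPred_eq,
        realExtension_intCast, Int.cast_le]
    · simp only [side, sign, Finset.mem_filter, hp, hpa, and_false, if_false, Set.mem_ofPred_eq,
        realExtension_intCast, Int.cast_le, LinearMap.neg_apply]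
      omega
  refine ⟨cell '' (sign '' S), ?_, ?_, ?_, ?_⟩
  · refine Set.Finite.image _ (Set.Finite.subset K.powerset.finite_toSet ?_)
    rintro _ ⟨a, -, rfl⟩
    exact Finset.mem_coe.2 (Finset.mem_powerset.2 (Finset.filter_subset _ _))
  · rintro _ ⟨σ, -, rfl⟩
    refine ⟨side σ '' K, K.finite_toSet.image _, ?_, rfl⟩
    rintro _ ⟨p, hp, rfl⟩
    by_cases h : p ∈ σ
    · simp only [side, h, if_true]
      exact (hK p hp).isFacetHalfSpace _
    · simp only [side, h, if_false]
      exact (hK p hp).neg.isFacetHalfSpace _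
  · rintro _ ⟨_, ⟨a, -, rfl⟩, rfl⟩ _ ⟨_, ⟨b, -, rfl⟩, rfl⟩ hne
    rw [Function.onFun, id, id, Set.disjoint_left]
    intro x hxa hxb
    apply hne
    have : sign a = sign b := by
      refine Finset.filter_congr fun p hp => ?_
      have h1 := hxa _ ⟨p, hp, rfl⟩
      have h2 := hxb _ ⟨p, hp, rfl⟩
      by_cases hpa : p.1 a ≤ p.2 <;> by_cases hpb : p.1 b ≤ p.2 <;>
        simp only [hpa, hpb] <;>
        simp only [side, sign, Finset.mem_filter, hp, hpa, hpb, and_false, and_self, if_true,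
          if_false, Set.mem_ofPred_eq, hneg] at h1 h2 <;>
        push_cast at h1 h2 <;> linarith
    rw [this]
  · ext a
    constructor
    · intro ha
      exact ⟨_, ⟨_, ⟨a, ha, rfl⟩, rfl⟩, hself a⟩
    · rintro ⟨_, ⟨_, ⟨b, hb, rfl⟩, rfl⟩, h⟩
      exact hS b hb a (hmem b a h)

/-- Membership in `α + F - Q` or `α - F + Q` is decided by finitely many inequalities `t x ≤ c`
with `t` vanishing on a facet. -/
theorem exists_finset_mem_summandSupport_iff (hQ : IsNormalAffineSemigroup Q) (c : SummandType)
    (α : Fin d → ℤ) {F : Set (Fin d → ℤ)} (hF : IsFace Q F) :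
    ∃ K : Finset (((Fin d → ℤ) →ₗ[ℤ] ℤ) × ℤ), (∀ p ∈ K, IsFacetFunctional Q p.1) ∧
      ∀ x, x ∈ summandSupport Q c α F ↔ ∀ p ∈ K, p.1 x ≤ p.2 := by
  classical
  obtain ⟨N, hN, hmem⟩ := hF.exists_facetFunctionals hQ
  cases c with
  | injective =>
    refine ⟨N.image fun t => (t, t α), ?_, fun x => ?_⟩
    · simpa using hN
    · have : x ∈ summandSupport Q .injective α F ↔ α - x ∈ hF.localization := by
        simp only [summandSupport, Set.mem_ofPred_eq, hF.mem_localization]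
        refine exists_congr fun f => and_congr_right fun _ => exists_congr fun q =>
          and_congr_right fun _ => ⟨?_, fun h => ?_⟩
        · rintro rfl; abel
        · rw [sub_eq_iff_eq_add] at h; rw [h]; abel
      rw [this, hmem]
      simp
  | flat =>
    refine ⟨N.image fun t => (-t, -t α), ?_, fun x => ?_⟩
    · simpa using fun t ht => (hN t ht).neg
    · have : x ∈ summandSupport Q .flat α F ↔ x - α ∈ hF.localization := by
        simp only [summandSupport, Set.mem_ofPred_eq, hF.mem_localization]
        refine exists_congr fun f => and_congr_right fun _ => exists_congr fun q =>
          and_congr_right fun _ => ⟨?_, fun h => ?_⟩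
        · rintro rfl; abel
        · rw [sub_eq_iff_eq_add] at h; rw [h]; abel
      rw [this, hmem]
      simp

end Polyhedra

/-! ### Homogeneous components in graded modules -/

namespace ZGradedModule

variable {k : Type u} [Field k] {d : ℕ} {Q : AddSubmonoid (Fin d → ℤ)}

/-- A graded module as the direct sum of its graded pieces. -/
noncomputable def degEquiv (M : ZGradedModule.{u, v} k Q) :
    (DirectSum _ fun β => M.deg β) ≃ₗ[k] M.carrier :=
  LinearEquiv.ofBijective (DirectSum.coeLinearMap M.deg)
    (show Function.Bijective (DirectSum.coeLinearMap M.deg) from M.isInternal)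

/-- The projection of a graded module onto its graded piece of degree `α`. -/
noncomputable def proj (M : ZGradedModule.{u, v} k Q) (α : Fin d → ℤ) :
    M.carrier →ₗ[k] M.carrier :=
  (M.deg α).subtype ∘ₗ DirectSum.component k _ (fun β => M.deg β) α ∘ₗ M.degEquiv.symm.toLinearMap

variable (M : ZGradedModule.{u, v} k Q) {N : ZGradedModule.{u, w} k Q}

theorem proj_mem (α : Fin d → ℤ) (m : M.carrier) : M.proj α m ∈ M.deg α :=
  Submodule.coe_mem _

theorem degEquiv_symm_of_mem {β : Fin d → ℤ} {m : M.carrier} (hm : m ∈ M.deg β) :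
    M.degEquiv.symm m = DirectSum.lof k _ (fun β => M.deg β) β ⟨m, hm⟩ := by
  rw [LinearEquiv.symm_apply_eq]
  exact (DirectSum.coeLinearMap_lof M.deg β ⟨m, hm⟩).symm

theorem proj_of_mem {α : Fin d → ℤ} {m : M.carrier} (hm : m ∈ M.deg α) : M.proj α m = m := by
  simp [proj, M.degEquiv_symm_of_mem hm, DirectSum.component.lof_self]

theorem proj_of_mem_of_ne {α β : Fin d → ℤ} {m : M.carrier} (hm : m ∈ M.deg β) (h : β ≠ α) :
    M.proj α m = 0 := by
  simp [proj, M.degEquiv_symm_of_mem hm, DirectSum.component.of, h]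

theorem homogeneous_induction {p : M.carrier → Prop} (m : M.carrier)
    (mem : ∀ α, ∀ m ∈ M.deg α, p m) (add : ∀ x y, p x → p y → p (x + y)) : p m := by
  have hm : m ∈ ⨆ β, M.deg β := by rw [M.isInternal.submodule_iSup_eq_top]; trivial
  exact Submodule.iSup_induction M.deg (motive := p) hm mem (mem 0 0 (Submodule.zero_mem _)) add

theorem exists_sum_proj (m : M.carrier) : ∃ s : Finset (Fin d → ℤ),
    (∀ β, β ∉ s → M.proj β m = 0) ∧ ∑ β ∈ s, M.proj β m = m := by
  classical
  have key : ∃ s : Finset (Fin d → ℤ), ∀ s', s ⊆ s' →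
      (∀ β, β ∉ s' → M.proj β m = 0) ∧ ∑ β ∈ s', M.proj β m = m := by
    induction m using M.homogeneous_induction with
    | mem α m hm =>
      refine ⟨{α}, fun s' hs' => ⟨fun β hβ => M.proj_of_mem_of_ne hm ?_, ?_⟩⟩
      · rintro rfl; exact hβ (hs' (by simp))
      · rw [Finset.sum_eq_single α (fun β _ hβ => M.proj_of_mem_of_ne hm hβ.symm)
          (fun h => absurd (hs' (by simp)) h), M.proj_of_mem hm]
    | add x y hx hy =>
      obtain ⟨s, hs⟩ := hx
      obtain ⟨t, ht⟩ := hy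
      refine ⟨s ∪ t, fun s' hs' => ?_⟩
      obtain ⟨h1, h2⟩ := hs s' (Finset.union_subset_left hs')
      obtain ⟨h3, h4⟩ := ht s' (Finset.union_subset_right hs')
      refine ⟨fun β hβ => by rw [map_add, h1 β hβ, h3 β hβ, add_zero], ?_⟩
      simp only [map_add, Finset.sum_add_distrib, h2, h4]
  obtain ⟨s, hs⟩ := key
  exact ⟨s, hs s subset_rfl⟩

variable {M}

theorem IsGradedHom.map_proj {f : M.carrier →ₗ[AddMonoidAlgebra k Q] N.carrier}
    (hf : M.IsGradedHom N f) (α : Fin d → ℤ) (m : M.carrier) :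
    f (M.proj α m) = N.proj α (f m) := by
  induction m using M.homogeneous_induction with
  | mem β m hm =>
    by_cases h : β = α
    · subst h
      rw [M.proj_of_mem hm, N.proj_of_mem (hf _ _ hm)]
    · rw [M.proj_of_mem_of_ne hm h, N.proj_of_mem_of_ne (hf _ _ hm) h, map_zero]
  | add x y hx hy => simp only [map_add, hx, hy]

end ZGradedModule

/-! ### Coordinates with respect to a decomposition -/

section Monomial

variable {k : Type u} [Field k] {d : ℕ} {T : Set (Fin d → ℤ)}

theorem monomialAction_apply {a : Fin d → ℤ} (m : T →₀ k)
    (β : Fin d → ℤ) (h : β + a ∈ T) [Decidable (β ∈ T)] :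
    monomialAction k T a m ⟨β + a, h⟩ = if h' : β ∈ T then m ⟨β, h'⟩ else 0 := by
  classical
  induction m using Finsupp.induction_linear with
  | zero => simp
  | add f g hf hg =>
    rw [map_add, Finsupp.add_apply, hf, hg]
    split_ifs <;> simp
  | single γ c =>
    obtain ⟨γ, hγ⟩ := γ
    simp only [monomialAction, Finsupp.linearCombination_single, Finsupp.smul_apply]
    by_cases hγβ : γ = β
    · subst hγβ
      simp [h, hγ]
    · have h1 : (if h : γ + a ∈ T then Finsupp.single (⟨γ + a, h⟩ : T) (1 : k) else 0)
          ⟨β + a, h⟩ = 0 := by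
        split_ifs with h2
        · rw [Finsupp.single_apply, if_neg]
          simpa using hγβ
        · rfl
      rw [h1]
      split_ifs with h3
      · rw [Finsupp.single_apply, if_neg]
        · simp
        · simpa using hγβ
      · simp

theorem eq_of_mem_monomialDeg {β : Fin d → ℤ} {m : T →₀ k} (hm : m ∈ monomialDeg k T β)
    [Decidable (β ∈ T)] :
    m = if h : β ∈ T then Finsupp.single ⟨β, h⟩ (m ⟨β, h⟩) else 0 := by
  ext ⟨γ, hγ⟩
  by_cases h : γ = β
  · subst h
    simp [hγ]
  · have h0 : m ⟨γ, hγ⟩ = 0 := by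
      by_contra hne
      exact h (hm (Finsupp.mem_support_iff.2 hne))
    rw [h0]
    split_ifs with h'
    · rw [Finsupp.single_apply, if_neg]
      simpa using Ne.symm h
    · rfl

end Monomial

namespace SummandDecomposition

variable {k : Type u} [Field k] {d : ℕ} {Q : AddSubmonoid (Fin d → ℤ)}
  {c : SummandType} {J' : ZGradedModule.{u, v'} k Q} {J : ZGradedModule.{u, v} k Q}

theorem component_add (D : SummandDecomposition c J) (i : Fin D.r) (z w : J.carrier) :
    D.component i (z + w) = D.component i z + D.component i w := by
  unfold component
  rw [map_add]; rfl

theorem component_smul (D : SummandDecomposition c J) (i : Fin D.r) (a : k) (z : J.carrier) :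
    D.component i (a • z) = a • D.component i z := by
  unfold component
  exact congrFun (LinearMap.map_smul_of_tower D.equiv.toLinearMap a z) i

theorem component_monomial_smul (D : SummandDecomposition c J) (i : Fin D.r) (a : Q)
    (z : J.carrier) :
    D.component i (AddMonoidAlgebra.single a (1 : k) • z) =
      monomialAction k (D.supp i) a (D.component i z) := by
  unfold component
  rw [map_smul]
  change monomialAlgHom k (summandSupport_convex Q c (D.vec i) (D.face i))
    (AddMonoidAlgebra.single a 1) _ = _
  rw [monomialAlgHom_single]
  rfl

theorem ext_component (D : SummandDecomposition c J) {z w : J.carrier}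
    (h : ∀ i, D.component i z = D.component i w) : z = w :=
  D.equiv.injective (funext h)

theorem component_mem (D : SummandDecomposition c J) (i : Fin D.r) {α : Fin d → ℤ}
    {z : J.carrier} (hz : z ∈ J.deg α) : D.component i z ∈ monomialDeg k (D.supp i) α :=
  D.isGraded α z hz i trivial

theorem mem_deg_of_component_mem (D : SummandDecomposition c J) {α : Fin d → ℤ} {z : J.carrier}
    (hz : ∀ i, D.component i z ∈ monomialDeg k (D.supp i) α) : z ∈ J.deg α := by
  have h1 := D.isGraded.map_proj α z
  have h2 : D.equiv z ∈ (ZGradedModule.directSum fun i =>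
      monomialModule k (summandSupport_convex Q c (D.vec i) (D.face i))).deg α :=
    fun i _ => hz i
  rw [LinearEquiv.coe_coe, ZGradedModule.proj_of_mem _ h2] at h1
  rw [← D.equiv.injective h1]
  exact J.proj_mem α z

theorem component_basisElement_self (D : SummandDecomposition c J) (i : Fin D.r) (β : D.supp i) :
    D.component i (D.basisElement i β) = Finsupp.single β 1 := by
  exact (congrFun (D.equiv.apply_symm_apply _) i).trans (Pi.single_eq_same i _)

theorem component_basisElement_of_ne (D : SummandDecomposition c J) {i j : Fin D.r} (h : j ≠ i)
    (β : D.supp i) : D.component j (D.basisElement i β) = 0 := by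
  exact (congrFun (D.equiv.apply_symm_apply _) j).trans (Pi.single_eq_of_ne h _)

theorem basisElement_mem (D : SummandDecomposition c J) (i : Fin D.r) (β : D.supp i) :
    D.basisElement i β ∈ J.deg β := by
  refine D.mem_deg_of_component_mem fun j => ?_
  by_cases h : j = i
  · subst h
    rw [component_basisElement_self]
    exact Finsupp.single_mem_supported k _ rfl
  · rw [component_basisElement_of_ne D h]
    exact Submodule.zero_mem _

open Classical in
/-- The coefficient of `x^α` in the `i`-th summand, as a functional on `J`; it is zero if `α` is
not a degree of that summand. -/
noncomputable def coeff (D : SummandDecomposition c J) (i : Fin D.r) (α : Fin d → ℤ) :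
    J.carrier →ₗ[k] k where
  toFun z := if h : α ∈ D.supp i then D.component i z ⟨α, h⟩ else 0
  map_add' z w := by
    rw [component_add]
    split_ifs <;> simp
  map_smul' a z := by
    rw [component_smul]
    split_ifs <;> simp

open Classical in
/-- The element `x^α` of the `i`-th summand, or zero if `α` is not a degree of that summand. -/
noncomputable def monomial (D : SummandDecomposition c J) (i : Fin D.r) (α : Fin d → ℤ) :
    J.carrier :=
  if h : α ∈ D.supp i then D.basisElement i ⟨α, h⟩ else 0

theorem coord_apply (D : SummandDecomposition c J) (A : Finset (Fin D.r)) (α : Fin d → ℤ)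
    (z : J.carrier) (i : A) : D.coord A α z i = D.coeff i α z := rfl

open Classical in
theorem coeff_apply (D : SummandDecomposition c J) (i : Fin D.r) (α : Fin d → ℤ)
    (z : J.carrier) :
    D.coeff i α z = if h : α ∈ D.supp i then D.component i z ⟨α, h⟩ else 0 := rfl

theorem coeff_of_notMem (D : SummandDecomposition c J) {i : Fin D.r} {α : Fin d → ℤ}
    (h : α ∉ D.supp i) (z : J.carrier) : D.coeff i α z = 0 := by
  rw [coeff_apply, dif_neg h]

theorem mem_active (D : SummandDecomposition c J) {i : Fin D.r} {α : Fin d → ℤ} :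
    i ∈ D.active α ↔ α ∈ D.supp i := by
  simp [active]

theorem monomial_mem (D : SummandDecomposition c J) (i : Fin D.r) (α : Fin d → ℤ) :
    D.monomial i α ∈ J.deg α := by
  unfold monomial
  split_ifs with h
  · exact D.basisElement_mem i ⟨α, h⟩
  · exact Submodule.zero_mem _

theorem monomial_of_mem (D : SummandDecomposition c J) {i : Fin D.r} {α : Fin d → ℤ}
    (h : α ∈ D.supp i) : D.monomial i α = D.basisElement i ⟨α, h⟩ := by
  rw [monomial, dif_pos h]

theorem monomial_of_notMem (D : SummandDecomposition c J) {i : Fin D.r} {α : Fin d → ℤ}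
    (h : α ∉ D.supp i) : D.monomial i α = 0 := by
  rw [monomial, dif_neg h]

theorem coeff_monomial_self (D : SummandDecomposition c J) {i : Fin D.r} {α : Fin d → ℤ}
    (h : α ∈ D.supp i) : D.coeff i α (D.monomial i α) = 1 := by
  rw [coeff_apply, dif_pos h, D.monomial_of_mem h, component_basisElement_self]
  simp

theorem coeff_monomial_of_ne (D : SummandDecomposition c J) {i j : Fin D.r} (hij : j ≠ i)
    (α : Fin d → ℤ) : D.coeff j α (D.monomial i α) = 0 := by
  by_cases h : α ∈ D.supp i
  · rw [coeff_apply, D.monomial_of_mem h, component_basisElement_of_ne D hij]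
    split_ifs <;> rfl
  · rw [D.monomial_of_notMem h, map_zero]

theorem eq_zero_of_coeff (D : SummandDecomposition c J) {α : Fin d → ℤ} {z : J.carrier}
    (hz : z ∈ J.deg α) (h : ∀ i, D.coeff i α z = 0) : z = 0 := by
  classical
  refine D.ext_component fun i => ?_
  have h0 : D.component i 0 = 0 := by
    have := D.component_smul i 0 0
    rwa [zero_smul, zero_smul] at this
  rw [h0, eq_of_mem_monomialDeg (D.component_mem i hz)]
  have := h i
  rw [coeff_apply] at this
  split_ifs with hα
  · rw [dif_pos hα] at this
    rw [this, Finsupp.single_zero]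
  · rfl

theorem eq_sum_coeff_smul_monomial (D : SummandDecomposition c J) {α : Fin d → ℤ} {z : J.carrier}
    (hz : z ∈ J.deg α) : z = ∑ i, D.coeff i α z • D.monomial i α := by
  rw [← sub_eq_zero]
  refine D.eq_zero_of_coeff (sub_mem hz (Submodule.sum_mem _ fun i _ =>
    Submodule.smul_mem _ _ (D.monomial_mem i α))) fun j => ?_
  rw [map_sub, map_sum, Finset.sum_eq_single j]
  · by_cases h : α ∈ D.supp j
    · rw [map_smul, D.coeff_monomial_self h, smul_eq_mul, mul_one, sub_self]
    · simp [D.coeff_of_notMem h]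
  · intro i _ hij
    rw [map_smul, D.coeff_monomial_of_ne hij.symm, smul_zero]
  · simp

theorem coeff_monomial_smul (D : SummandDecomposition c J) (i : Fin D.r) (a : Q)
    {α : Fin d → ℤ} (h : α + a ∈ D.supp i) (z : J.carrier) :
    D.coeff i (α + a) (AddMonoidAlgebra.single a (1 : k) • z) = D.coeff i α z := by
  classical
  rw [coeff_apply, dif_pos h, component_monomial_smul,
    monomialAction_apply, coeff_apply]

theorem single_smul_monomial (D : SummandDecomposition c J) (i : Fin D.r) (a : Q)
    {α : Fin d → ℤ} (h : α ∈ D.supp i) :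
    AddMonoidAlgebra.single a (1 : k) • D.monomial i α = D.monomial i (α + a) := by
  rw [← sub_eq_zero]
  refine D.eq_zero_of_coeff (α := α + a)
    (sub_mem (J.monomial_smul_mem a α _ (D.monomial_mem i α)) (D.monomial_mem i _)) fun j => ?_
  by_cases hj : α + a ∈ D.supp j
  · rw [map_sub, D.coeff_monomial_smul j a hj]
    by_cases hij : j = i
    · subst hij
      rw [D.coeff_monomial_self h, D.coeff_monomial_self hj, sub_self]
    · rw [D.coeff_monomial_of_ne hij, D.coeff_monomial_of_ne hij, sub_self]
  · rw [D.coeff_of_notMem hj]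

theorem coord_injective (D : SummandDecomposition c J) {A : Finset (Fin D.r)} {α : Fin d → ℤ}
    (hA : D.active α = A) {z w : J.carrier} (hz : z ∈ J.deg α) (hw : w ∈ J.deg α)
    (h : D.coord A α z = D.coord A α w) : z = w := by
  rw [← sub_eq_zero]
  refine D.eq_zero_of_coeff (sub_mem hz hw) fun i => ?_
  by_cases hi : α ∈ D.supp i
  · have := congrFun h ⟨i, hA ▸ D.mem_active.2 hi⟩
    rw [coord_apply, coord_apply] at this
    rw [map_sub, this, sub_self]
  · exact D.coeff_of_notMem hi _

theorem exists_coord_eq (D : SummandDecomposition c J) {A : Finset (Fin D.r)} {α : Fin d → ℤ}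
    (hA : D.active α = A) (y : A → k) : ∃ z ∈ J.deg α, D.coord A α z = y := by
  refine ⟨∑ i : A, y i • D.monomial i α,
    Submodule.sum_mem _ fun i _ => Submodule.smul_mem _ _ (D.monomial_mem i α), ?_⟩
  funext j
  rw [coord_apply, map_sum, Finset.sum_eq_single j]
  · rw [map_smul, D.coeff_monomial_self (D.mem_active.1 (hA ▸ j.2)), smul_eq_mul, mul_one]
  · intro i _ hij
    rw [map_smul, D.coeff_monomial_of_ne (fun h => hij (Subtype.ext h.symm)), smul_zero]
  · simp

/-- In coordinates, multiplication by `x^(β - α)` sends `e_i` to `e_i` or to `0`. -/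
theorem coord_mulMonomial (D : SummandDecomposition c J) {A B : Finset (Fin D.r)}
    {α β : Fin d → ℤ} (hA : D.active α = A) (hB : D.active β = B) (h : β - α ∈ Q)
    (z : J.deg α) :
    D.coord B β (J.mulMonomial h z : J.carrier) = restrictCoord A B (D.coord A α z) := by
  funext i
  have hi : β ∈ D.supp i := D.mem_active.1 (hB ▸ i.2)
  obtain ⟨a, rfl⟩ : ∃ a : Q, β = α + a := ⟨⟨β - α, h⟩, by simp⟩
  have ha : (⟨α + a - α, h⟩ : Q) = a := Subtype.ext (by simp)
  rw [coord_apply]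
  change D.coeff i (α + a) (AddMonoidAlgebra.single (⟨α + a - α, h⟩ : Q) (1 : k) •
    (z : J.carrier)) = _
  rw [ha, D.coeff_monomial_smul _ _ hi, restrictCoord]
  split_ifs with h'
  · rfl
  · exact D.coeff_of_notMem (fun hα => h' (hA ▸ D.mem_active.2 hα)) _

end SummandDecomposition

/-! ### Monomial matrices and uniqueness of decompositions -/

section Supports

variable {d : ℕ} {Q : AddSubmonoid (Fin d → ℤ)} {F F' : Set (Fin d → ℤ)}
  {α α' : Fin d → ℤ}

theorem IsFace.nsmul_mem (hF : IsFace Q F) {a : Fin d → ℤ} (ha : a ∈ F) (n : ℕ) : n • a ∈ F := by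
  induction n with
  | zero => simpa using hF.zero_mem
  | succ n ih => rw [succ_nsmul]; exact hF.add_mem ih ha

theorem mem_summandSupport_self (c : SummandType) (hF : IsFace Q F) :
    α ∈ summandSupport Q c α F := by
  cases c <;> exact ⟨0, hF.zero_mem, 0, Q.zero_mem, by simp⟩

theorem summandSupport_injective_sub {x a : Fin d → ℤ}
    (hx : x ∈ summandSupport Q .injective α F) (ha : a ∈ Q) :
    x - a ∈ summandSupport Q .injective α F := by
  obtain ⟨f, hf, q, hq, rfl⟩ := hx
  exact ⟨f, hf, q + a, Q.add_mem hq ha, by abel⟩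

theorem summandSupport_flat_add {x a : Fin d → ℤ}
    (hx : x ∈ summandSupport Q .flat α F) (ha : a ∈ Q) :
    x + a ∈ summandSupport Q .flat α F := by
  obtain ⟨f, hf, q, hq, rfl⟩ := hx
  exact ⟨f, hf, q + a, Q.add_mem hq ha, by abel⟩

theorem summandSupport_subset (c : SummandType) (hF : IsFace Q F) (h : F' ⊆ F)
    (hα : α' ∈ summandSupport Q c α F) :
    summandSupport Q c α' F' ⊆ summandSupport Q c α F := by
  cases c with
  | injective =>
    rintro _ ⟨f, hf, q, hq, rfl⟩
    obtain ⟨g, hg, p, hp, rfl⟩ := hα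
    exact ⟨g + f, hF.add_mem hg (h hf), p + q, Q.add_mem hp hq, by abel⟩
  | flat =>
    rintro _ ⟨f, hf, q, hq, rfl⟩
    obtain ⟨g, hg, p, hp, rfl⟩ := hα
    exact ⟨g + f, hF.add_mem hg (h hf), p + q, Q.add_mem hp hq, by abel⟩

/-- The functional defining `F` is bounded above on `α + F - Q` and below on `α - F + Q`, hence
cannot be positive at `f` if the former contains all `α' + n f`, or the latter all `α' - n f`. -/
theorem face_subset_of_summandSupport_subset (c : SummandType) (hF : IsFace Q F)
    (hF' : IsFace Q F') (h : summandSupport Q c α' F' ⊆ summandSupport Q c α F) : F' ⊆ F := by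
  intro f hf
  obtain ⟨l, hl, hlF⟩ := hF.exists_nonneg
  refine (hlF f).2 ⟨hF'.subset hf, le_antisymm ?_ (hl f (hF'.subset hf))⟩
  have key : ∃ C : ℝ, ∀ n : ℕ, n * l f ≤ C := by
    cases c with
    | injective =>
      refine ⟨l α - l α', fun n => ?_⟩
      obtain ⟨g, hg, q, hq, e⟩ := h ⟨n • f, hF'.nsmul_mem hf n, 0, Q.zero_mem, rfl⟩
      have e' := congrArg l e
      simp only [map_add, map_sub, map_nsmul, map_zero, ((hlF g).1 hg).2] at e'
      rw [nsmul_eq_mul] at e'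
      linarith [hl q hq]
    | flat =>
      refine ⟨l α' - l α, fun n => ?_⟩
      obtain ⟨g, hg, q, hq, e⟩ := h ⟨n • f, hF'.nsmul_mem hf n, 0, Q.zero_mem, rfl⟩
      have e' := congrArg l e
      simp only [map_add, map_sub, map_nsmul, map_zero, ((hlF g).1 hg).2] at e'
      rw [nsmul_eq_mul] at e'
      linarith [hl q hq]
  obtain ⟨C, hC⟩ := key
  by_contra! hpos
  obtain ⟨n, hn⟩ := exists_nat_gt (C / l f)
  rw [div_lt_iff₀ hpos] at hn
  exact absurd (hC n) (not_le.2 hn)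

/-- The condition under which `k{T'} → k{T}` can be nonzero, for `T' = α' + F' - Q` and
`T = α + F - Q`, respectively `T' = α' - F' + Q` and `T = α - F + Q`. -/
def AllowsNonzeroHom (Q : AddSubmonoid (Fin d → ℤ)) (c : SummandType) (α' : Fin d → ℤ)
    (F' : Set (Fin d → ℤ)) (α : Fin d → ℤ) (F : Set (Fin d → ℤ)) : Prop :=
  match c with
  | .injective => F ⊆ F' ∧ α ∈ summandSupport Q .injective α' F'
  | .flat => F' ⊆ F ∧ α' ∈ summandSupport Q .flat α F

/-- The scalars by which a homomorphism `k{T'} → k{T}` acts in the various degrees agree on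
`T' ∩ T`, and if they are nonzero, then `T ⊆ T'` in the injective and `T' ⊆ T` in the flat case:
any two degrees have a common translate by elements of `-Q`, respectively of `Q`. -/
theorem exists_scalar_of_summandSupport {k : Type*} [Zero k] (hQ : IsNormalAffineSemigroup Q)
    (c : SummandType) (hF : IsFace Q F) (hF' : IsFace Q F') (g : (Fin d → ℤ) → k)
    (hg' : ∀ x, x ∉ summandSupport Q c α' F' → g x = 0)
    (hg : ∀ x, x ∉ summandSupport Q c α F → g x = 0)
    (hadd : ∀ x ∈ summandSupport Q c α' F', ∀ a ∈ Q, x + a ∈ summandSupport Q c α F →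
      g (x + a) = g x) :
    ∃ s : k, (∀ x ∈ summandSupport Q c α' F', x ∈ summandSupport Q c α F → g x = s) ∧
      (s ≠ 0 → AllowsNonzeroHom Q c α' F' α F) := by
  by_cases hne : ∃ x₀ ∈ summandSupport Q c α' F', x₀ ∈ summandSupport Q c α F
  swap
  · push Not at hne
    exact ⟨0, fun x h1 h2 => absurd h2 (hne x h1), fun h => absurd rfl h⟩
  obtain ⟨x₀, hx₀', hx₀⟩ := hne
  refine ⟨g x₀, ?_⟩
  cases c with
  | injective =>
    have key : ∀ y ∈ summandSupport Q .injective α F, g y = g x₀ := by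
      intro y hy
      obtain ⟨a, ha, b, hb, e⟩ := hQ.exists_sub (x₀ - y)
      have hz := summandSupport_injective_sub hx₀' ha
      have e1 : x₀ - a + a = x₀ := by abel
      have e2 : x₀ - a + b = y := by
        rw [sub_eq_sub_iff_add_eq_add] at e
        rw [sub_add_eq_add_sub, e]
        abel
      have h1 := hadd _ hz a ha (by rwa [e1])
      have h2 := hadd _ hz b hb (by rwa [e2])
      rw [e1] at h1
      rw [e2] at h2
      rw [h1, h2]
    refine ⟨fun x _ hx => key x hx, fun h0 => ?_⟩
    have hsub : summandSupport Q .injective α F ⊆ summandSupport Q .injective α' F' := by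
      intro y hy
      by_contra hy'
      exact h0 ((key y hy).symm.trans (hg' y hy'))
    exact ⟨face_subset_of_summandSupport_subset _ hF' hF hsub,
      hsub (mem_summandSupport_self _ hF)⟩
  | flat =>
    have key : ∀ y ∈ summandSupport Q .flat α' F', g y = g x₀ := by
      intro y hy
      obtain ⟨a, ha, b, hb, e⟩ := hQ.exists_sub (y - x₀)
      have hz := summandSupport_flat_add hx₀ ha
      have e2 : y + b = x₀ + a := by
        rw [sub_eq_sub_iff_add_eq_add] at e
        rw [e]
        abel
      have h1 := hadd _ hx₀' a ha hz
      have h2 := hadd _ hy b hb (by rwa [e2])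
      rw [e2] at h2
      rw [← h1, ← h2]
    refine ⟨fun x hx _ => key x hx, fun h0 => ?_⟩
    have hsub : summandSupport Q .flat α' F' ⊆ summandSupport Q .flat α F := by
      intro y hy
      by_contra hy'
      exact h0 ((key y hy).symm.trans (hg y hy'))
    exact ⟨face_subset_of_summandSupport_subset _ hF hF' hsub,
      hsub (mem_summandSupport_self _ hF')⟩

end Supports

namespace SummandDecomposition

variable {k : Type u} [Field k] {d : ℕ} {Q : AddSubmonoid (Fin d → ℤ)}
  {c : SummandType} {J' : ZGradedModule.{u, v'} k Q} {J : ZGradedModule.{u, v} k Q}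

theorem exists_represents (hQ : IsNormalAffineSemigroup Q) (D' : SummandDecomposition c J')
    (D : SummandDecomposition c J) (f : J'.carrier →ₗ[AddMonoidAlgebra k Q] J.carrier)
    (hf : J'.IsGradedHom J f) : ∃ L, D'.Represents D L f := by
  classical
  have key : ∀ q p, ∃ s : k,
      (∀ x ∈ D'.supp q, x ∈ D.supp p → D.coeff p x (f (D'.monomial q x)) = s) ∧
      (s ≠ 0 → AllowsNonzeroHom Q c (D'.vec q) (D'.face q) (D.vec p) (D.face p)) := by
    intro q p
    refine exists_scalar_of_summandSupport hQ c (D.isFace p) (D'.isFace q)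
      (fun x => D.coeff p x (f (D'.monomial q x))) ?_ ?_ ?_
    · intro x hx
      rw [D'.monomial_of_notMem hx, map_zero, map_zero]
    · intro x hx
      exact D.coeff_of_notMem hx _
    · intro x hx a ha hxa
      rw [← D'.single_smul_monomial q ⟨a, ha⟩ hx, map_smul]
      exact D.coeff_monomial_smul p ⟨a, ha⟩ hxa _
  choose L hL hL0 using key
  refine ⟨L, ?_, ?_⟩
  · cases c with
    | injective =>
      intro q p h
      by_contra h0
      exact h (hL0 q p h0)
    | flat =>
      intro q p h
      by_contra h0
      exact h (hL0 q p h0)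
  · intro q β p
    rw [eq_of_mem_monomialDeg (D.component_mem p (hf _ _ (D'.basisElement_mem q β)))]
    split_ifs with h
    · have h1 := hL q p β β.2 h
      rw [coeff_apply, dif_pos h, D'.monomial_of_mem β.2] at h1
      rw [h1]
    · rfl

variable {D' : SummandDecomposition c J'} {D : SummandDecomposition c J}
  {L : Matrix (Fin D'.r) (Fin D.r) k} {f : J'.carrier →ₗ[AddMonoidAlgebra k Q] J.carrier}

theorem Represents.coeff_apply_monomial (hL : D'.Represents D L f) {q : Fin D'.r} {p : Fin D.r}
    {α : Fin d → ℤ} (hq : α ∈ D'.supp q) (hp : α ∈ D.supp p) :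
    D.coeff p α (f (D'.monomial q α)) = L q p := by
  rw [coeff_apply, dif_pos hp, D'.monomial_of_mem hq, hL.2 q ⟨α, hq⟩ p, dif_pos hp]
  simp

theorem Represents.coord_apply (hL : D'.Represents D L f) {A' : Finset (Fin D'.r)}
    {A : Finset (Fin D.r)} {α : Fin d → ℤ} (hA' : D'.active α = A') (hA : D.active α = A)
    {z : J'.carrier} (hz : z ∈ J'.deg α) :
    D.coord A α (f z) = submatrixMap L A' A (D'.coord A' α z) := by
  funext p
  have hp : α ∈ D.supp p := D.mem_active.1 (hA ▸ p.2)
  have h1 : D.coeff p α (f z) =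
      ∑ q, D'.coeff q α z * D.coeff p α (f (D'.monomial q α)) := by
    conv_lhs => rw [D'.eq_sum_coeff_smul_monomial hz]
    rw [map_sum, map_sum]
    refine Finset.sum_congr rfl fun q _ => ?_
    rw [LinearMap.map_smul_of_tower, map_smul, smul_eq_mul]
  rw [SummandDecomposition.coord_apply, h1]
  change _ = ∑ q : A', D'.coeff q α z * L q p
  rw [Finset.sum_coe_sort A' fun q => D'.coeff q α z * L q p]
  symm
  apply Finset.sum_subset_zero_on_sdiff (Finset.subset_univ A')
  · intro q hq
    have : α ∉ D'.supp q := fun h => (Finset.mem_sdiff.1 hq).2 (hA' ▸ D'.mem_active.2 h)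
    rw [D'.coeff_of_notMem this, zero_mul]
  · intro q hq
    rw [hL.coeff_apply_monomial (D'.mem_active.1 (hA' ▸ hq)) hp]

theorem isGradedHom_id : J.IsGradedHom J LinearMap.id := fun _ _ h => h

theorem Represents.supp_subset {D₁ D₂ : SummandDecomposition c J}
    {L₁₂ : Matrix (Fin D₁.r) (Fin D₂.r) k} {L₂₁ : Matrix (Fin D₂.r) (Fin D₁.r) k}
    (h₁₂ : D₁.Represents D₂ L₁₂ LinearMap.id) (h₂₁ : D₂.Represents D₁ L₂₁ LinearMap.id) :
    Set.range D₁.supp ⊆ Set.range D₂.supp := by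
  rintro _ ⟨i, rfl⟩
  have hα : D₁.vec i ∈ D₁.supp i := mem_summandSupport_self c (D₁.isFace i)
  have hz := D₁.monomial_mem i (D₁.vec i)
  have e1 := h₁₂.coord_apply rfl rfl hz
  have e2 := h₂₁.coord_apply rfl rfl hz
  simp only [LinearMap.id_apply] at e1 e2
  have e3 := congrFun e2 ⟨i, D₁.mem_active.2 hα⟩
  rw [SummandDecomposition.coord_apply, D₁.coeff_monomial_self hα] at e3
  have e4 : (1 : k) = ∑ j : D₂.active (D₁.vec i),
      D₂.coord (D₂.active (D₁.vec i)) (D₁.vec i) (D₁.monomial i (D₁.vec i)) j * L₂₁ j i := e3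
  obtain ⟨j, -, hj⟩ := Finset.exists_ne_zero_of_sum_ne_zero (e4 ▸ one_ne_zero)
  have hj1 := left_ne_zero_of_mul hj
  have hj2 := right_ne_zero_of_mul hj
  rw [SummandDecomposition.coord_apply] at hj1
  have hj1' : L₁₂ i j ≠ 0 := by
    rwa [← h₁₂.coeff_apply_monomial hα (D₂.mem_active.1 j.2)]
  refine ⟨j, ?_⟩
  have n1 := h₁₂.1
  have n2 := h₂₁.1
  cases c with
  | injective =>
    obtain ⟨a1, a2⟩ := not_not.1 (mt (n1 i j) hj1')
    obtain ⟨b1, b2⟩ := not_not.1 (mt (n2 j i) hj2)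
    exact subset_antisymm (summandSupport_subset _ (D₁.isFace i) a1 a2)
      (summandSupport_subset _ (D₂.isFace j) b1 b2)
  | flat =>
    obtain ⟨a1, a2⟩ := not_not.1 (mt (n1 i j) hj1')
    obtain ⟨b1, b2⟩ := not_not.1 (mt (n2 j i) hj2)
    exact subset_antisymm (summandSupport_subset _ (D₁.isFace i) b1 b2)
      (summandSupport_subset _ (D₂.isFace j) a1 a2)

/-- The sets of degrees of the summands do not depend on the decomposition: some product of
entries of mutually inverse change of basis matrices is nonzero, which forces equality. -/
theorem range_supp_eq (hQ : IsNormalAffineSemigroup Q) (D₁ D₂ : SummandDecomposition c J) :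
    Set.range D₁.supp = Set.range D₂.supp := by
  obtain ⟨L, hL⟩ := exists_represents hQ D₁ D₂ LinearMap.id isGradedHom_id
  obtain ⟨L', hL'⟩ := exists_represents hQ D₂ D₁ LinearMap.id isGradedHom_id
  exact subset_antisymm (hL.supp_subset hL') (hL'.supp_subset hL)

theorem active_eq_iff (D : SummandDecomposition c J) {α β : Fin d → ℤ} :
    D.active α = D.active β ↔ ∀ T ∈ Set.range D.supp, α ∈ T ↔ β ∈ T := by
  simp [Finset.ext_iff, mem_active]

theorem active_eq_iff_active_eq (hQ : IsNormalAffineSemigroup Q) (D₁ D₂ : SummandDecomposition c J)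
    {α β : Fin d → ℤ} : D₁.active α = D₁.active β ↔ D₂.active α = D₂.active β := by
  rw [active_eq_iff, active_eq_iff, range_supp_eq hQ D₁ D₂]

end SummandDecomposition

/-! ### Homology in a fixed degree -/

section Homology

variable {k : Type u} [Field k] {d : ℕ} {Q : AddSubmonoid (Fin d → ℤ)}
  {J' : ZGradedModule.{u, v'} k Q} {J : ZGradedModule.{u, v} k Q}
  {J'' : ZGradedModule.{u, v''} k Q} {H : ZGradedModule.{u, w} k Q}
  {φ : J'.carrier →ₗ[AddMonoidAlgebra k Q] J.carrier}
  {ψ : J.carrier →ₗ[AddMonoidAlgebra k Q] J''.carrier}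
  {e : MiddleHomology φ ψ ≃ₗ[AddMonoidAlgebra k Q] H.carrier}

/-- Coordinates on the graded piece `J_α`. -/
noncomputable def SummandDecomposition.coordEquiv {c : SummandType} (D : SummandDecomposition c J)
    {A : Finset (Fin D.r)} {α : Fin d → ℤ} (hA : D.active α = A) : J.deg α ≃ₗ[k] (A → k) :=
  LinearEquiv.ofBijective
    (LinearMap.pi (fun i : A => D.coeff i α) ∘ₗ (J.deg α).subtype)
    ⟨fun z w h => Subtype.ext (D.coord_injective hA z.2 w.2 h), fun y => by
      obtain ⟨z, hz, h⟩ := D.exists_coord_eq hA y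
      exact ⟨⟨z, hz⟩, h⟩⟩

theorem SummandDecomposition.coordEquiv_apply {c : SummandType} (D : SummandDecomposition c J)
    {A : Finset (Fin D.r)} {α : Fin d → ℤ} (hA : D.active α = A) (z : J.deg α) :
    D.coordEquiv hA z = D.coord A α z := rfl

/-- The elements of `H_α` are the classes of the cycles of degree `α`. -/
theorem exists_cycle_of_mem_deg (hψ : J.IsGradedHom J'' ψ) (he : IsGradedHomologyIso φ ψ e)
    {α : Fin d → ℤ} {x : H.carrier} (hx : x ∈ H.deg α) :
    ∃ z : LinearMap.ker ψ, (z : J.carrier) ∈ J.deg α ∧ e (Submodule.Quotient.mk z) = x := by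
  obtain ⟨q, rfl⟩ := e.surjective x
  obtain ⟨z, rfl⟩ := Submodule.Quotient.mk_surjective _ q
  have hker : ∀ β, J.proj β z ∈ LinearMap.ker ψ := fun β => by
    rw [LinearMap.mem_ker, hψ.map_proj, LinearMap.mem_ker.1 z.2, map_zero]
  refine ⟨⟨J.proj α z, hker α⟩, J.proj_mem _ _, ?_⟩
  obtain ⟨s, hs0, hs⟩ := J.exists_sum_proj (z : J.carrier)
  have hz : z = ∑ β ∈ s, ⟨J.proj β z, hker β⟩ := by
    apply Subtype.ext
    rw [AddSubmonoidClass.coe_finsetSum, hs]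
  let g : LinearMap.ker ψ →+ H.carrier :=
    e.toLinearMap.toAddMonoidHom.comp (Submodule.mkQ _).toAddMonoidHom
  have hg : ∀ β (h : J.proj β z ∈ LinearMap.ker ψ), g ⟨J.proj β z, h⟩ ∈ H.deg β :=
    fun β h => he β ⟨_, h⟩ (J.proj_mem β _)
  have h1 : H.proj α (g z) = g z := H.proj_of_mem hx
  have h2 : H.proj α (g z) = g ⟨J.proj α z, hker α⟩ := by
    conv_lhs => rw [hz]
    rw [map_sum, map_sum, Finset.sum_eq_single α]
    · exact H.proj_of_mem (hg α _)
    · exact fun β _ hβ => H.proj_of_mem_of_ne (hg β _) hβ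
    · intro hα
      have : (⟨J.proj α z, hker α⟩ : LinearMap.ker ψ) = 0 := Subtype.ext (hs0 α hα)
      rw [this, map_zero, map_zero]
  exact h2.symm.trans h1

theorem ZGradedModule.IsGradedHom.exists_mem_deg_eq (hφ : J'.IsGradedHom J φ) {α : Fin d → ℤ}
    {z : J.carrier} (hz : z ∈ J.deg α) (h : z ∈ LinearMap.range φ) : ∃ w ∈ J'.deg α, φ w = z := by
  obtain ⟨w, rfl⟩ := h
  exact ⟨J'.proj α w, J'.proj_mem _ _, by rw [hφ.map_proj, J.proj_of_mem hz]⟩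

namespace SummandDecomposition

variable {c : SummandType} {D' : SummandDecomposition c J'} {D : SummandDecomposition c J}
  {D'' : SummandDecomposition c J''} {Φ : Matrix (Fin D'.r) (Fin D.r) k}
  {Ψ : Matrix (Fin D.r) (Fin D''.r) k} {A' : Finset (Fin D'.r)} {A : Finset (Fin D.r)}
  {A'' : Finset (Fin D''.r)} {α : Fin d → ℤ}

theorem Represents.coord_mem_ker_iff (hΨ : D.Represents D'' Ψ ψ) (hψ : J.IsGradedHom J'' ψ)
    (hA : D.active α = A) (hA'' : D''.active α = A'') {z : J.carrier} (hz : z ∈ J.deg α) :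
    D.coord A α z ∈ LinearMap.ker (submatrixMap Ψ A A'') ↔ z ∈ LinearMap.ker ψ := by
  rw [LinearMap.mem_ker, LinearMap.mem_ker, ← hΨ.coord_apply hA hA'' hz]
  constructor
  · intro h
    refine D''.coord_injective hA'' (hψ _ _ hz) (Submodule.zero_mem _) (h.trans ?_)
    funext i
    rw [SummandDecomposition.coord_apply, map_zero]; rfl
  · intro h
    funext i
    rw [h, SummandDecomposition.coord_apply, map_zero]; rfl

theorem Represents.coord_mem_range_iff (hΦ : D'.Represents D Φ φ) (hφ : J'.IsGradedHom J φ)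
    (hA' : D'.active α = A') (hA : D.active α = A) {z : J.carrier} (hz : z ∈ J.deg α) :
    D.coord A α z ∈ LinearMap.range (submatrixMap Φ A' A) ↔ z ∈ LinearMap.range φ := by
  constructor
  · rintro ⟨y, hy⟩
    obtain ⟨w, hw, rfl⟩ := D'.exists_coord_eq hA' y
    rw [← hΦ.coord_apply hA' hA hw] at hy
    exact ⟨w, D.coord_injective hA (hφ _ _ hw) hz hy⟩
  · intro h
    obtain ⟨w, hw, rfl⟩ := hφ.exists_mem_deg_eq hz h
    exact ⟨_, (hΦ.coord_apply hA' hA hw).symm⟩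

theorem Represents.exists_cycle_coord_eq (hΨ : D.Represents D'' Ψ ψ) (hψ : J.IsGradedHom J'' ψ)
    (hA : D.active α = A) (hA'' : D''.active α = A'')
    (y : LinearMap.ker (submatrixMap Ψ A A'')) :
    ∃ z : LinearMap.ker ψ, (z : J.carrier) ∈ J.deg α ∧ D.coord A α z = y := by
  obtain ⟨z, hz, h⟩ := D.exists_coord_eq hA (y : A → k)
  exact ⟨⟨z, (hΨ.coord_mem_ker_iff hψ hA hA'' hz).1 (h ▸ y.2)⟩, hz, h⟩

/-- The isomorphism `η` is induced by the coordinates on `J_α`: the class in `H` of a cycle of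
degree `α` goes to the class of its coordinate vector. -/
def IsInducedByCoord (D : SummandDecomposition c J)
    (e : MiddleHomology φ ψ ≃ₗ[AddMonoidAlgebra k Q] H.carrier) (Φ : Matrix (Fin D'.r) (Fin D.r) k)
    (Ψ : Matrix (Fin D.r) (Fin D''.r) k) (A' : Finset (Fin D'.r)) (A : Finset (Fin D.r))
    (A'' : Finset (Fin D''.r)) {α : Fin d → ℤ}
    (η : H.deg α ≃ₗ[k] SubmatrixHomology Φ Ψ A' A A'') : Prop :=
  ∀ (x : H.deg α) (z : LinearMap.ker ψ), (z : J.carrier) ∈ J.deg α →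
    e (Submodule.Quotient.mk z) = x →
    ∃ hz : D.coord A α z ∈ LinearMap.ker (submatrixMap Ψ A A''),
      η x = Submodule.Quotient.mk ⟨D.coord A α z, hz⟩

/-- The coordinates on `J_α` induce an isomorphism from `H_α` to the homology of the submatrices
of the monomial matrices. -/
theorem exists_deg_equiv_submatrixHomology (hφ : J'.IsGradedHom J φ) (hψ : J.IsGradedHom J'' ψ)
    (he : IsGradedHomologyIso φ ψ e) (hΦ : D'.Represents D Φ φ) (hΨ : D.Represents D'' Ψ ψ)
    (hα : α ∈ D'.sector D D'' A' A A'') :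
    ∃ η : H.deg α ≃ₗ[k] SubmatrixHomology Φ Ψ A' A A'',
      IsInducedByCoord D e Φ Ψ A' A A'' η := by
  obtain ⟨hA', hA, hA''⟩ := hα
  have hker : ∀ y : LinearMap.ker (submatrixMap Ψ A A''),
      ((D.coordEquiv hA).symm y : J.carrier) ∈ LinearMap.ker ψ := fun y => by
    rw [← hΨ.coord_mem_ker_iff hψ hA hA'' (Submodule.coe_mem _), ← D.coordEquiv_apply hA,
      LinearEquiv.apply_symm_apply]
    exact y.2
  let G : LinearMap.ker (submatrixMap Ψ A A'') →ₗ[k] H.deg α :=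
    { toFun := fun y => ⟨e (Submodule.Quotient.mk ⟨(D.coordEquiv hA).symm y, hker y⟩),
        he _ _ (Submodule.coe_mem _)⟩
      map_add' := fun y y' => by
        apply Subtype.ext
        simp only [Submodule.coe_add]
        rw [← map_add, ← Submodule.Quotient.mk_add]
        congr 2
        apply Subtype.ext
        simp
      map_smul' := fun a y => by
        apply Subtype.ext
        simp only [Submodule.coe_smul, RingHom.id_apply]
        refine Eq.trans ?_ (LinearMap.map_smul_of_tower e.toLinearMap a _)
        change e _ = e _
        congr 1
        rw [← Submodule.Quotient.mk_smul]
        congr 1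
        apply Subtype.ext
        simp }
  have hG : ∀ y, (G y : H.carrier) =
    e (Submodule.Quotient.mk ⟨(D.coordEquiv hA).symm y, hker y⟩) := fun y => rfl
  have hGz : ∀ (z : LinearMap.ker ψ), (z : J.carrier) ∈ J.deg α →
      ∀ hz' : D.coord A α z ∈ LinearMap.ker (submatrixMap Ψ A A''),
      (G ⟨D.coord A α z, hz'⟩ : H.carrier) = e (Submodule.Quotient.mk z) := by
    intro z hz hz'
    rw [hG]
    congr 2
    apply Subtype.ext
    have : (D.coordEquiv hA).symm (D.coord A α z) = ⟨z, hz⟩ := by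
      rw [LinearEquiv.symm_apply_eq]; rfl
    simp only [this]
  have hsurj : Function.Surjective G := by
    intro x
    obtain ⟨z, hz, hzx⟩ := exists_cycle_of_mem_deg hψ he x.2
    exact ⟨⟨D.coord A α z, (hΨ.coord_mem_ker_iff hψ hA hA'' hz).2 z.2⟩,
      Subtype.ext ((hGz z hz _).trans hzx)⟩
  have hkerG : (LinearMap.range (submatrixMap Φ A' A)).comap
      (LinearMap.ker (submatrixMap Ψ A A'')).subtype = LinearMap.ker G := by
    ext ⟨y, hy⟩
    obtain ⟨z, hz, rfl⟩ := hΨ.exists_cycle_coord_eq hψ hA hA'' ⟨y, hy⟩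
    rw [Submodule.mem_comap, LinearMap.mem_ker, ← Submodule.coe_eq_zero, hGz z hz,
      LinearEquiv.map_eq_zero_iff, Submodule.Quotient.mk_eq_zero, Submodule.mem_comap]
    exact hΦ.coord_mem_range_iff hφ hA' hA hz
  let η := ((Submodule.quotEquivOfEq _ _ hkerG).trans (G.quotKerEquivOfSurjective hsurj)).symm
  refine ⟨η, fun x z hz hzx => ?_⟩
  have hz' := (hΨ.coord_mem_ker_iff hψ hA hA'' hz).2 z.2
  refine ⟨hz', ?_⟩
  rw [LinearEquiv.symm_apply_eq]
  exact Subtype.ext (hzx.symm.trans (hGz z hz hz').symm)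

end SummandDecomposition

end Homology

/-! ### The sector partition -/

section Sectors

variable {k : Type u} [Field k] {d : ℕ} {Q : AddSubmonoid (Fin d → ℤ)}
  {J' : ZGradedModule.{u, v'} k Q} {J : ZGradedModule.{u, v} k Q}
  {J'' : ZGradedModule.{u, v''} k Q} {H : ZGradedModule.{u, w} k Q}
  {φ : J'.carrier →ₗ[AddMonoidAlgebra k Q] J.carrier}
  {ψ : J.carrier →ₗ[AddMonoidAlgebra k Q] J''.carrier}
  {e : MiddleHomology φ ψ ≃ₗ[AddMonoidAlgebra k Q] H.carrier}

namespace SummandDecomposition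

variable {c : SummandType} {D' : SummandDecomposition c J'} {D : SummandDecomposition c J}
  {D'' : SummandDecomposition c J''} {Φ : Matrix (Fin D'.r) (Fin D.r) k}
  {Ψ : Matrix (Fin D.r) (Fin D''.r) k} {A' B' : Finset (Fin D'.r)} {A B : Finset (Fin D.r)}
  {A'' B'' : Finset (Fin D''.r)} {α β : Fin d → ℤ}

/-- In coordinates, multiplication by `x^(β - α)` on homology is induced by `e_i ↦ e_i` or
`e_i ↦ 0`. -/
theorem IsInducedByCoord.mulMonomial (hψ : J.IsGradedHom J'' ψ) (he : IsGradedHomologyIso φ ψ e)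
    (hΨ : D.Represents D'' Ψ ψ)
    (hα : α ∈ D'.sector D D'' A' A A'') (hβ : β ∈ D'.sector D D'' B' B B'')
    {η : H.deg α ≃ₗ[k] SubmatrixHomology Φ Ψ A' A A''}
    {ζ : H.deg β ≃ₗ[k] SubmatrixHomology Φ Ψ B' B B''}
    (hη : IsInducedByCoord D e Φ Ψ A' A A'' η) (hζ : IsInducedByCoord D e Φ Ψ B' B B'' ζ)
    (h : β - α ∈ Q) (y : LinearMap.ker (submatrixMap Ψ A A'')) :
    ∃ hy : restrictCoord A B (y : A → k) ∈ LinearMap.ker (submatrixMap Ψ B B''),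
      ζ (H.mulMonomial h (η.symm (Submodule.Quotient.mk y))) =
        Submodule.Quotient.mk ⟨restrictCoord A B (y : A → k), hy⟩ := by
  obtain ⟨y, hy⟩ := y
  obtain ⟨z, hz, rfl⟩ := hΨ.exists_cycle_coord_eq hψ hα.2.1 hα.2.2 ⟨y, hy⟩
  obtain ⟨hz', e1⟩ := hη ⟨e (Submodule.Quotient.mk z), he α z hz⟩ z hz rfl
  rw [← LinearEquiv.eq_symm_apply] at e1
  let w : LinearMap.ker ψ := AddMonoidAlgebra.single (⟨β - α, h⟩ : Q) (1 : k) • z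
  have hw : (w : J.carrier) = J.mulMonomial h ⟨z, hz⟩ := rfl
  have hwcoord : D.coord B β w = restrictCoord A B (D.coord A α z) := by
    rw [hw, D.coord_mulMonomial hα.2.1 hβ.2.1]
  obtain ⟨hw', e2⟩ := hζ (H.mulMonomial h ⟨e (Submodule.Quotient.mk z), he α z hz⟩) w
    (J.mulMonomial h ⟨z, hz⟩).2 (map_smul e _ (Submodule.Quotient.mk z))
  refine ⟨hwcoord ▸ hw', ?_⟩
  rw [← e1, e2]
  congr 1
  exact Subtype.ext hwcoord

/-- The identification of the homologies of submatrices for two decompositions does not depend on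
the degree chosen in the sector, being induced by a submatrix of the change of basis matrix. -/
theorem IsInducedByCoord.comp_symm_apply (hQ : IsNormalAffineSemigroup Q)
    (hψ : J.IsGradedHom J'' ψ) (he : IsGradedHomologyIso φ ψ e)
    {E' : SummandDecomposition c J'} {E : SummandDecomposition c J}
    {E'' : SummandDecomposition c J''} {Φ' : Matrix (Fin E'.r) (Fin E.r) k}
    {Ψ' : Matrix (Fin E.r) (Fin E''.r) k} {C' : Finset (Fin E'.r)} {C : Finset (Fin E.r)}
    {C'' : Finset (Fin E''.r)} (hΨ : D.Represents D'' Ψ ψ)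
    (hα : α ∈ D'.sector D D'' A' A A'') (hβ : β ∈ D'.sector D D'' A' A A'')
    (hα' : α ∈ E'.sector E E'' C' C C'') (hβ' : β ∈ E'.sector E E'' C' C C'')
    {η : H.deg α ≃ₗ[k] SubmatrixHomology Φ Ψ A' A A''}
    {ζ : H.deg β ≃ₗ[k] SubmatrixHomology Φ Ψ A' A A''}
    {η' : H.deg α ≃ₗ[k] SubmatrixHomology Φ' Ψ' C' C C''}
    {ζ' : H.deg β ≃ₗ[k] SubmatrixHomology Φ' Ψ' C' C C''}
    (hη : IsInducedByCoord D e Φ Ψ A' A A'' η) (hζ : IsInducedByCoord D e Φ Ψ A' A A'' ζ)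
    (hη' : IsInducedByCoord E e Φ' Ψ' C' C C'' η') (hζ' : IsInducedByCoord E e Φ' Ψ' C' C C'' ζ')
    (x : H.deg β) : η' (η.symm (ζ x)) = ζ' x := by
  obtain ⟨L, hL⟩ := exists_represents hQ D E LinearMap.id isGradedHom_id
  obtain ⟨z, hz, hzx⟩ := exists_cycle_of_mem_deg hψ he x.2
  obtain ⟨hz1, e1⟩ := hζ x z hz hzx
  obtain ⟨hz2, e2⟩ := hζ' x z hz hzx
  obtain ⟨z₀, hz₀, hzz₀⟩ := hΨ.exists_cycle_coord_eq hψ hα.2.1 hα.2.2 ⟨D.coord A β z, hz1⟩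
  obtain ⟨hz3, e3⟩ := hη ⟨e (Submodule.Quotient.mk z₀), he α z₀ hz₀⟩ z₀ hz₀ rfl
  obtain ⟨hz4, e4⟩ := hη' ⟨e (Submodule.Quotient.mk z₀), he α z₀ hz₀⟩ z₀ hz₀ rfl
  have h1 : ζ x = η ⟨e (Submodule.Quotient.mk z₀), he α z₀ hz₀⟩ := by
    rw [e1, e3]
    congr 1
    exact Subtype.ext hzz₀.symm
  rw [h1, LinearEquiv.symm_apply_apply, e4, e2]
  congr 1
  apply Subtype.ext
  have h2 := hL.coord_apply hα.2.1 hα'.2.1 hz₀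
  have h3 := hL.coord_apply hβ.2.1 hβ'.2.1 hz
  simp only [LinearMap.id_apply] at h2 h3
  change E.coord C α z₀ = E.coord C β z
  rw [h2, h3, hzz₀]

variable (D' D D'') in
/-- The nonempty sets among the `S_{A',A,A''}`. -/
def sectorSet : Set (Set (Fin d → ℤ)) :=
  {S | S.Nonempty ∧ ∃ A' A A'', S = D'.sector D D'' A' A A''}

theorem sector_eq_of_mem (hα : α ∈ D'.sector D D'' A' A A'') :
    D'.sector D D'' A' A A'' = {β | D'.active β = D'.active α ∧ D.active β = D.active α ∧
      D''.active β = D''.active α} := by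
  obtain ⟨rfl, rfl, rfl⟩ := hα
  rfl

theorem sectorSet_eq_range : D'.sectorSet D D'' = Set.range fun α =>
    {β | D'.active β = D'.active α ∧ D.active β = D.active α ∧ D''.active β = D''.active α} := by
  ext S
  constructor
  · rintro ⟨⟨α, hα⟩, A', A, A'', rfl⟩
    exact ⟨α, (sector_eq_of_mem hα).symm⟩
  · rintro ⟨α, rfl⟩
    exact ⟨⟨α, rfl, rfl, rfl⟩, _, _, _, rfl⟩

theorem sectorSet_eq (hQ : IsNormalAffineSemigroup Q) (D' E' : SummandDecomposition c J')
    (D E : SummandDecomposition c J) (D'' E'' : SummandDecomposition c J'') :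
    D'.sectorSet D D'' = E'.sectorSet E E'' := by
  rw [sectorSet_eq_range, sectorSet_eq_range]
  simp only [active_eq_iff_active_eq hQ D' E', active_eq_iff_active_eq hQ D E,
    active_eq_iff_active_eq hQ D'' E'']

theorem eq_sector_of_mem_sectorSet {S : Set (Fin d → ℤ)} (hS : S ∈ D'.sectorSet D D'')
    (hα : α ∈ S) : S = D'.sector D D'' (D'.active α) (D.active α) (D''.active α) := by
  obtain ⟨-, A', A, A'', rfl⟩ := hS
  exact sector_eq_of_mem hα

variable (D' D D'') in
theorem sectorSet_finite : (D'.sectorSet D D'').Finite := by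
  refine (Set.finite_range fun p : Finset (Fin D'.r) × Finset (Fin D.r) × Finset (Fin D''.r) =>
    D'.sector D D'' p.1 p.2.1 p.2.2).subset ?_
  rintro _ ⟨-, A', A, A'', rfl⟩
  exact ⟨(A', A, A''), rfl⟩

variable (D' D D'') in
theorem sectorSet_isPartition : Setoid.IsPartition (D'.sectorSet D D'') := by
  refine ⟨fun h => Set.not_nonempty_empty h.1, fun α =>
    ⟨D'.sector D D'' (D'.active α) (D.active α) (D''.active α),
      ⟨⟨⟨α, rfl, rfl, rfl⟩, _, _, _, rfl⟩, rfl, rfl, rfl⟩, ?_⟩⟩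
  rintro S ⟨hS, hα⟩
  exact eq_sector_of_mem_sectorSet hS hα

theorem exists_finset_active_eq (hQ : IsNormalAffineSemigroup Q) (D : SummandDecomposition c J) :
    ∃ K : Finset (((Fin d → ℤ) →ₗ[ℤ] ℤ) × ℤ), (∀ p ∈ K, IsFacetFunctional Q p.1) ∧
      ∀ α β, (∀ p ∈ K, p.1 α ≤ p.2 ↔ p.1 β ≤ p.2) → D.active α = D.active β := by
  classical
  choose K hK hmem using fun i =>
    exists_finset_mem_summandSupport_iff hQ c (D.vec i) (D.isFace i)
  refine ⟨Finset.univ.biUnion K, fun p hp => ?_, fun α β h => ?_⟩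
  · obtain ⟨i, -, hi⟩ := Finset.mem_biUnion.1 hp
    exact hK i p hi
  · ext i
    rw [mem_active, mem_active]
    refine ((hmem i α).trans ?_).trans (hmem i β).symm
    exact forall₂_congr fun p hp => h p (Finset.mem_biUnion.2 ⟨i, Finset.mem_univ i, hp⟩)

theorem isPolyhedralRegion_of_mem_sectorSet (hQ : IsNormalAffineSemigroup Q)
    {S : Set (Fin d → ℤ)} (hS : S ∈ D'.sectorSet D D'') : IsPolyhedralRegion Q S := by
  classical
  obtain ⟨K', hK', h'⟩ := exists_finset_active_eq hQ D'
  obtain ⟨K, hK, h⟩ := exists_finset_active_eq hQ D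
  obtain ⟨K'', hK'', h''⟩ := exists_finset_active_eq hQ D''
  refine isPolyhedralRegion_of_finset (K' ∪ K ∪ K'') ?_ S ?_
  · intro p hp
    simp only [Finset.mem_union] at hp
    rcases hp with (hp | hp) | hp
    exacts [hK' p hp, hK p hp, hK'' p hp]
  · obtain ⟨-, A', A, A'', rfl⟩ := hS
    rintro a ⟨rfl, rfl, rfl⟩ b hab
    refine ⟨(h' a b fun p hp => hab p ?_).symm, (h a b fun p hp => hab p ?_).symm,
      (h'' a b fun p hp => hab p ?_).symm⟩ <;> simp [hp]

end SummandDecomposition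

open SummandDecomposition

theorem exists_sectorPartition_isComputedBy (hQ : IsNormalAffineSemigroup Q)
    (hφ : J'.IsGradedHom J φ) (hψ : J.IsGradedHom J'' ψ) (he : IsGradedHomologyIso φ ψ e)
    {c : SummandType} (E' : SummandDecomposition c J') (E : SummandDecomposition c J)
    (E'' : SummandDecomposition c J'') :
    ∃ P : SectorPartition H, ∀ (D' : SummandDecomposition c J') (D : SummandDecomposition c J)
      (D'' : SummandDecomposition c J''), P.IsComputedBy φ ψ e D' D D'' := by
  obtain ⟨Φ₀, hΦ₀⟩ := exists_represents hQ E' E φ hφ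
  obtain ⟨Ψ₀, hΨ₀⟩ := exists_represents hQ E E'' ψ hψ
  have hne : ∀ S : E'.sectorSet E E'', ∃ α, α ∈ S.1 := fun S => S.2.1
  choose rep hrep using hne
  have hsec : ∀ (S : E'.sectorSet E E'') (α : Fin d → ℤ), α ∈ S.1 →
      α ∈ E'.sector E E'' (E'.active (rep S)) (E.active (rep S)) (E''.active (rep S)) :=
    fun S α hα => eq_sector_of_mem_sectorSet S.2 (hrep S) ▸ hα
  choose iso hiso using fun (S : E'.sectorSet E E'') (α : Fin d → ℤ) (hα : α ∈ S.1) =>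
    exists_deg_equiv_submatrixHomology hφ hψ he hΦ₀ hΨ₀ (hsec S α hα)
  choose src hsrc tgt htgt hdiff using
    fun (S T : E'.sectorSet E E'') (h : ∃ α ∈ S.1, ∃ β ∈ T.1, β - α ∈ Q) => h
  let P : SectorPartition H :=
    { sectors := E'.sectorSet E E''
      finite := sectorSet_finite E' E E''
      isPartition := sectorSet_isPartition E' E E''
      polyhedral := fun S hS => isPolyhedralRegion_of_mem_sectorSet hQ hS
      space := fun S => SubmatrixHomology Φ₀ Ψ₀ (E'.active (rep S)) (E.active (rep S))
        (E''.active (rep S))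
      iso := iso
      map := fun S T h => (iso T _ (htgt S T h)).toLinearMap ∘ₗ H.mulMonomial (hdiff S T h) ∘ₗ
        (iso S _ (hsrc S T h)).symm.toLinearMap
      comm := by
        intro S T α β hα hβ h x
        obtain ⟨y, hy⟩ := Submodule.Quotient.mk_surjective _ (iso S α hα x)
        have hST : ∃ α ∈ S.1, ∃ β ∈ T.1, β - α ∈ Q := ⟨α, hα, β, hβ, h⟩
        obtain ⟨_, e1⟩ := (hiso S _ (hsrc S T hST)).mulMonomial hψ he hΨ₀ (hsec S _ (hsrc S T hST))
          (hsec T _ (htgt S T hST)) (hiso T _ (htgt S T hST)) (hdiff S T hST) y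
        obtain ⟨_, e2⟩ := (hiso S α hα).mulMonomial hψ he hΨ₀ (hsec S α hα)
          (hsec T β hβ) (hiso T β hβ) h y
        rw [hy] at e1 e2
        rw [LinearEquiv.symm_apply_apply] at e2
        exact e1.trans e2.symm }
  refine ⟨P, fun D' D D'' => ?_⟩
  obtain ⟨Φ, hΦ⟩ := exists_represents hQ D' D φ hφ
  obtain ⟨Ψ, hΨ⟩ := exists_represents hQ D D'' ψ hψ
  choose η hη using fun A' A A'' α (hα : α ∈ D'.sector D D'' A' A A'') =>
    exists_deg_equiv_submatrixHomology hφ hψ he hΦ hΨ hα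
  refine ⟨Φ, Ψ, hΦ, hΨ, sectorSet_eq hQ E' D' E D E'' D'', fun A' A A'' h =>
    (iso ⟨_, h⟩ _ (hrep ⟨_, h⟩)).symm.trans (η A' A A'' _ (hrep ⟨_, h⟩)), ?_⟩
  have hθ : ∀ A' A A'' (h : D'.sector D D'' A' A A'' ∈ E'.sectorSet E E'') α
      (hα : α ∈ D'.sector D D'' A' A A'') (x : H.deg α),
      η A' A A'' _ (hrep ⟨_, h⟩) ((iso ⟨_, h⟩ _ (hrep ⟨_, h⟩)).symm (iso ⟨_, h⟩ α hα x)) =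
        η A' A A'' α hα x := fun A' A A'' h α hα x =>
    (hiso ⟨_, h⟩ _ (hrep ⟨_, h⟩)).comp_symm_apply hQ hψ he hΨ₀ (hsec ⟨_, h⟩ _ (hrep ⟨_, h⟩))
      (hsec ⟨_, h⟩ α hα) (hrep ⟨_, h⟩) hα (hiso ⟨_, h⟩ α hα) (hη A' A A'' _ (hrep ⟨_, h⟩))
      (hη A' A A'' α hα) x
  refine ⟨fun A' A A'' h α hα x z hz hzx => ?_, fun A' A A'' B' B B'' hA hB hAB y => ?_⟩
  · obtain ⟨hz', e1⟩ := hη A' A A'' α hα x z hz hzx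
    exact ⟨hz', (hθ A' A A'' h α hα x).trans e1⟩
  · obtain ⟨hy, e1⟩ := (hη A' A A'' _ (hsrc ⟨_, hA⟩ ⟨_, hB⟩ hAB)).mulMonomial hψ he hΨ
      (hsrc ⟨_, hA⟩ ⟨_, hB⟩ hAB) (htgt ⟨_, hA⟩ ⟨_, hB⟩ hAB)
      (hη B' B B'' _ (htgt ⟨_, hA⟩ ⟨_, hB⟩ hAB)) (hdiff ⟨_, hA⟩ ⟨_, hB⟩ hAB) y
    refine ⟨hy, Eq.trans ?_ e1⟩
    refine (hθ B' B B'' hB _ (htgt ⟨_, hA⟩ ⟨_, hB⟩ hAB) _).trans ?_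
    refine congrArg (fun x => η B' B B'' _ _ (H.mulMonomial (hdiff ⟨_, hA⟩ ⟨_, hB⟩ hAB) x)) ?_
    change (iso ⟨_, hA⟩ _ (hsrc ⟨_, hA⟩ ⟨_, hB⟩ hAB)).symm _ = _
    rw [LinearEquiv.symm_apply_eq]
    change (iso ⟨_, hA⟩ _ (hrep ⟨_, hA⟩)) ((η A' A A'' _ (hrep ⟨_, hA⟩)).symm _) = _
    rw [← LinearEquiv.eq_symm_apply, LinearEquiv.symm_apply_eq, hθ, LinearEquiv.apply_symm_apply]

end Sectors

/-- Over a normal semigroup ring `k[Q]`, the middle homology `H` of a complex `J' → J → J''` of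
injective (resp. flat) `ℤ^d`-graded modules has a sector partition determined by the complex: one
and the same sector partition of `H` is the one computed, via kernel modulo image of submatrices of
the monomial matrices, from every choice of direct sum decompositions of `J'`, `J`, `J''`. -/
theorem theoremt {k : Type u} [Field k] {d : ℕ} (Q : AddSubmonoid (Fin d → ℤ))
    (hQ : IsNormalAffineSemigroup Q)
    (J' : ZGradedModule.{u, v'} k Q) (J : ZGradedModule.{u, v} k Q)
    (J'' : ZGradedModule.{u, v''} k Q) (H : ZGradedModule.{u, w} k Q)
    (φ : J'.carrier →ₗ[AddMonoidAlgebra k Q] J.carrier) (hφ : J'.IsGradedHom J φ)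
    (ψ : J.carrier →ₗ[AddMonoidAlgebra k Q] J''.carrier) (hψ : J.IsGradedHom J'' ψ)
    (hcomplex : ψ ∘ₗ φ = 0)
    (e : MiddleHomology φ ψ ≃ₗ[AddMonoidAlgebra k Q] H.carrier)
    (he : IsGradedHomologyIso φ ψ e) :
    (J'.IsInjective ∧ J.IsInjective ∧ J''.IsInjective →
      ∃ P : SectorPartition H,
        ∀ (D' : SummandDecomposition .injective J') (D : SummandDecomposition .injective J)
          (D'' : SummandDecomposition .injective J''), P.IsComputedBy φ ψ e D' D D'') ∧
    (J'.IsFlat ∧ J.IsFlat ∧ J''.IsFlat →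
      ∃ P : SectorPartition H,
        ∀ (D' : SummandDecomposition .flat J') (D : SummandDecomposition .flat J)
          (D'' : SummandDecomposition .flat J''), P.IsComputedBy φ ψ e D' D D'') := by
  refine ⟨fun ⟨⟨D'⟩, ⟨D⟩, ⟨D''⟩⟩ => ?_, fun ⟨⟨D'⟩, ⟨D⟩, ⟨D''⟩⟩ => ?_⟩
  · exact exists_sectorPartition_isComputedBy hQ hφ hψ he D' D D''
  · exact exists_sectorPartition_isComputedBy hQ hφ hψ he D' D D''
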